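/- Fix $B=50000$. Let $n>1$ be odd and let $b,c$ be integers. Call $(b,c)$ admissible for $n$ if the Jacobi symbols satisfy $\left(\frac{b^2+4c}{n}\right)=-1$ and $\left(\frac{-c}{n}\right)=1$. For admissible $(b,c)$, work in the ring $R=\mathbb Z[x]/(n,\,x^2-bx-c)$ and write $n^2-1=2^rs$ with $s$ odd. Say that $n$ passes the Quadratic Frobenius Test (QFT) with parameters $(b,c)$ if all of the following hold: 1. no prime $p\le\min\{B,\sqrt n\}$ divides $n$; 2. $n$ is not a perfect square; 3. $x^{(n+1)/2}$ lies in the image of $\mathbb Z/n\mathbb Z$ in $R$; 4. $x^{n+1}=-c$ in $R$; 5. $x^s=1$ in $R$, or $x^{2^js}=-1$ in $R$ for some $j$ with $0\le j\le r-2$. Let $P(n)$ be the number of pairs $(b,c)$ modulo $n$ that are admissible for $n$ and for which $n$ passes the QFT with parameters $(b,c)$. Let $M(n)$ be the number of pairs $(b,c)$ modulo $n$ that satisfy at least one of: $(b,c)$ is admissible for $n$; $1<\gcd(b^2+4c,n)<n$; $1<\gcd(c,n)<n$. The probability that $n$ passes the Random Quadratic Frobenius Test is defined to be $P(n)/M(n)$.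 **Theorem 2.6.** For every odd composite $n$ one has $M(n)>0$, and $n$ passes the Random Quadratic Frobenius Test with probability $$\frac{P(n)}{M(n)}<\frac1{7710}.$$ -/

import Mathlib

namespace Grantham

/-- The modulus polynomial `x ^ 2 - b x - c`, with coefficients reduced mod `n`. -/
noncomputable def qftPoly (n : ℕ) (b c : ℤ) : Polynomial (ZMod n) :=
  Polynomial.X ^ 2 - Polynomial.C (b : ZMod n) * Polynomial.X - Polynomial.C (c : ZMod n)

/-- The ring `ℤ[x] / (n, x ^ 2 - b x - c)`. -/
abbrev QFTRing (n : ℕ) (b c : ℤ) : Type := AdjoinRoot (qftPoly n b c)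

/-- The class of `x` in `ℤ[x] / (n, x ^ 2 - b x - c)`. -/
noncomputable def qftX (n : ℕ) (b c : ℤ) : QFTRing n b c := AdjoinRoot.root (qftPoly n b c)

/-- The parameters `(b, c)` are admissible for `n`: the Jacobi symbols satisfy
`((b ^ 2 + 4 c) / n) = -1` and `(-c / n) = 1`. -/
def Admissible (n : ℕ) (b c : ℤ) : Prop :=
  jacobiSym (b ^ 2 + 4 * c) n = -1 ∧ jacobiSym (-c) n = 1

/-- Step 1: no prime up to `min (B, √n)` divides `n`. -/
def PassesStep1 (B n : ℕ) : Prop :=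
  ∀ p : ℕ, p.Prime → (p : ℝ) ≤ min (B : ℝ) (Real.sqrt n) → ¬ p ∣ n

/-- Step 2: `n` is not a perfect square. -/
def PassesStep2 (n : ℕ) : Prop := ¬ IsSquare n

/-- Step 3: `x ^ ((n + 1) / 2)` lies in (the image of) `ℤ / n`. -/
def PassesStep3 (n : ℕ) (b c : ℤ) : Prop :=
  ∃ a : ZMod n, qftX n b c ^ ((n + 1) / 2) = algebraMap (ZMod n) (QFTRing n b c) a

/-- Step 4: `x ^ (n + 1) = -c`. -/
def PassesStep4 (n : ℕ) (b c : ℤ) : Prop :=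
  qftX n b c ^ (n + 1) = -(c : QFTRing n b c)

/-- The exponent `r` in `n ^ 2 - 1 = 2 ^ r * s` with `s` odd (for `n > 1`). -/
def rExp (n : ℕ) : ℕ := padicValNat 2 (n ^ 2 - 1)

/-- The odd part `s` in `n ^ 2 - 1 = 2 ^ r * s` (for `n > 1`). -/
def sPart (n : ℕ) : ℕ := (n ^ 2 - 1) / 2 ^ rExp n

/-- Step 5: `x ^ s = 1`, or `x ^ (2 ^ j * s) = -1` for some `0 ≤ j ≤ r - 2`. -/
def PassesStep5 (n : ℕ) (b c : ℤ) : Prop :=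
  qftX n b c ^ sPart n = 1 ∨
    ∃ j : ℕ, j + 2 ≤ rExp n ∧ qftX n b c ^ (2 ^ j * sPart n) = -1

/-- `n` passes the Quadratic Frobenius Test with trial-division bound `B` and parameters
`(b, c)`. The test is only defined for odd `n > 1` and admissible parameters. -/
def PassesQFT (B n : ℕ) (b c : ℤ) : Prop :=
  1 < n ∧ Odd n ∧ Admissible n b c ∧
    PassesStep1 B n ∧ PassesStep2 n ∧ PassesStep3 n b c ∧ PassesStep4 n b c ∧ PassesStep5 n b c

open Classical in
/-- The number of pairs `(b, c)` mod `n` for which `n` passes the QFT. -/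
noncomputable def passCount (B n : ℕ) : ℕ :=
  ((Finset.range n ×ˢ Finset.range n).filter
    fun q : ℕ × ℕ => PassesQFT B n (q.1 : ℤ) (q.2 : ℤ)).card

open Classical in
/-- `M(n)`: the number of pairs `(b, c)` mod `n` that are admissible, or for which
`gcd (b ^ 2 + 4 c, n)` or `gcd (c, n)` is a nontrivial divisor of `n`. -/
noncomputable def pairCount (n : ℕ) : ℕ :=
  ((Finset.range n ×ˢ Finset.range n).filter fun q : ℕ × ℕ =>
    Admissible n (q.1 : ℤ) (q.2 : ℤ) ∨
    (1 < Nat.gcd (q.1 ^ 2 + 4 * q.2) n ∧ Nat.gcd (q.1 ^ 2 + 4 * q.2) n < n) ∨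
    (1 < Nat.gcd q.2 n ∧ Nat.gcd q.2 n < n)).card

/-- The probability that `n` passes the Random Quadratic Frobenius Test: the number `α` with
`passCount = α * M(n)` (meaningful when `M(n)` is nonzero). -/
noncomputable def rqftProbability (B n : ℕ) : ℝ := (passCount B n : ℝ) / (pairCount n : ℝ)

end Grantham

namespace Grantham

open Finset Polynomial

/-! Write P and M for the two counts. The bound follows from 4M ≥ n² and 30840·P < n², since 30840 =
4·7710. Only n with at least one passing pair matter, so n may be taken to be a non-square with all
prime factors above B = 50000.

For M, expand the indicator of admissibility in Jacobi symbols. Two of the four sums cancel under an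
affine change of c, and a third vanishes because a non-square n has a prime of odd multiplicity.
Hence exactly a quarter of the pairs with both symbols nonzero are admissible. Nearly all pairs with
a vanishing symbol are counted in M through a nontrivial gcd.

For P, passing means that x² - bx - c divides certain binomials modulo each prime p of n. Distinct
local quadratics are coprime, so at most N/2 of them divide a nonzero polynomial of degree N
(`two_mul_card_le_natDegree`). If n is not squarefree, quadratics dividing X^(n²-1) - 1 lift
uniquely along a square-zero ideal, which saves p². If n is squarefree with k primes, the Chinese
remainder theorem multiplies the local bounds, a gain of 2^k. At a split prime (square discriminant)
the degree falls from p² - 1 to p - 1, which saves a factor B. The number of inert primes is odd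
because the discriminant has symbol -1. So even k forces a split prime, and odd k gives at least two
split primes or none.

When all primes are inert and k = 3, the cofactor congruences x^(n/p-1) = 1 suffice. For k ≥ 5,
steps 3 and 5 synchronise the 2-parts of the orders across all primes and give (2^k + 2)/16^k. The
worst case k = 5 yields 34/2^20, which is the source of 1/7710. -/

/-! ### Jacobi symbol sums and the lower bound for M(n) -/

/-- A positive non-square has a prime factor of odd multiplicity. -/
theorem exists_prime_odd_multiplicity {n : ℕ} (hn : n ≠ 0) (hsq : ¬ IsSquare n) :
    ∃ p e m : ℕ, p.Prime ∧ Odd e ∧ ¬ p ∣ m ∧ n = p ^ e * m := by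
  have key : ∃ p, p.Prime ∧ Odd (n.factorization p) := by
    by_contra! h
    apply hsq
    refine ⟨n.factorization.prod fun p e => p ^ (e / 2), ?_⟩
    conv_lhs => rw [← Nat.prod_factorization_pow_eq_self hn]
    rw [← Finsupp.prod_mul]
    refine Finset.prod_congr rfl fun p hp => ?_
    have hp' : p.Prime := Nat.prime_of_mem_primeFactors (by simpa using hp)
    obtain ⟨k, hk⟩ := Nat.not_odd_iff_even.mp (h p hp')
    simp only [hk]
    rw [← pow_add]
    congr 1
    omega
  obtain ⟨p, hp, ho⟩ := key
  refine ⟨p, n.factorization p, n / p ^ n.factorization p, hp, ho,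
    Nat.not_dvd_ordCompl hp hn, (Nat.ordProj_mul_ordCompl_eq_self n p).symm⟩

/-- The Jacobi symbol as a function on residues. -/
def jac (n : ℕ) (a : ZMod n) : ℤ := jacobiSym (a.cast : ℤ) n

theorem jac_intCast (n : ℕ) (k : ℤ) : jac n (k : ZMod n) = jacobiSym k n := by
  rw [jac, ZMod.coe_intCast, ← jacobiSym.mod_left]

theorem jac_mul (n : ℕ) (a b : ZMod n) : jac n (a * b) = jac n a * jac n b := by
  obtain ⟨x, rfl⟩ := ZMod.intCast_surjective a
  obtain ⟨y, rfl⟩ := ZMod.intCast_surjective b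
  rw [← Int.cast_mul, jac_intCast, jac_intCast, jac_intCast, jacobiSym.mul_left]

theorem jac_trichotomy (n : ℕ) (a : ZMod n) : jac n a = 0 ∨ jac n a = 1 ∨ jac n a = -1 :=
  jacobiSym.trichotomy _ _

theorem jac_four {n : ℕ} (hodd : Odd n) : jac n 4 = 1 := by
  have := jac_intCast n 4
  rw [jacobiSym.at_four hodd] at this
  simpa using this

theorem isUnit_four {n : ℕ} (hodd : Odd n) : IsUnit (4 : ZMod n) := by
  have : IsUnit ((4 : ℕ) : ZMod n) := by
    rw [ZMod.isUnit_iff_coprime]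
    exact (Nat.Coprime.pow_left 2 (Nat.coprime_two_left.mpr hodd) : Nat.Coprime (2 ^ 2) n)
  exact_mod_cast this

/-- For b ≠ 0 a rescaling of c turns the inner sum into the Jacobi sum J(χ, χ) = -χ(-1). There are p
- 1 such b, and the row b = 0 contributes (p - 1)χ(-1), which cancels them. -/
theorem sum_quadraticChar_disc_mul {p : ℕ} [Fact p.Prime] (hp : p ≠ 2) :
    ∑ b : ZMod p, ∑ c : ZMod p,
      quadraticChar (ZMod p) (b ^ 2 + 4 * c) * quadraticChar (ZMod p) (-c) = 0 := by
  have hchar : ringChar (ZMod p) ≠ 2 := by rwa [ZMod.ringChar_zmod_n]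
  set χ := quadraticChar (ZMod p) with hχ
  have h1 : χ ≠ 1 := quadraticChar_ne_one hchar
  have h2 : (2 : ZMod p) ≠ 0 := Ring.two_ne_zero hchar
  have h4 : (4 : ZMod p) ≠ 0 := by
    have : (4 : ZMod p) = 2 * 2 := by norm_num
    rw [this]; exact mul_ne_zero h2 h2
  have hχ4 : χ 4 = 1 := by
    have := quadraticChar_sq_one' (F := ZMod p) h2
    rw [show (4 : ZMod p) = 2 ^ 2 by norm_num]; exact this
  have hinv : χ⁻¹ = χ := (quadraticChar_isQuadratic (ZMod p)).inv
  have hJ : ∑ s : ZMod p, χ s * χ (1 - s) = -χ (-1) := by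
    have := jacobiSum_nontrivial_inv h1
    rw [hinv, jacobiSum] at this
    exact this
  have hb : ∀ b : ZMod p, b ≠ 0 → ∑ c : ZMod p, χ (b ^ 2 + 4 * c) * χ (-c) = -χ (-1) := by
    intro b hb
    rw [← hJ]
    have hk : b ^ 2 / (-4) ≠ 0 := div_ne_zero (pow_ne_zero 2 hb) (neg_ne_zero.mpr h4)
    refine (Fintype.sum_equiv (Equiv.mulLeft₀ (b ^ 2 / (-4)) hk) _ _ fun s => ?_).symm
    have e1 : b ^ 2 + 4 * (b ^ 2 / (-4) * s) = b ^ 2 * (1 - s) := by field_simp; ring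
    have e2 : -(b ^ 2 / (-4) * s) * 4 = b ^ 2 * s := by field_simp
    have e3 : χ (-(b ^ 2 / (-4) * s)) = χ s := by
      have := congrArg χ e2
      rwa [map_mul, map_mul, hχ4, mul_one, quadraticChar_sq_one' hb, one_mul] at this
    change _ = χ (b ^ 2 + 4 * (b ^ 2 / (-4) * s)) * χ (-(b ^ 2 / (-4) * s))
    rw [e1, e3, map_mul, quadraticChar_sq_one' hb, one_mul, mul_comm]
  have h0 : ∑ c : ZMod p, χ ((0 : ZMod p) ^ 2 + 4 * c) * χ (-c) = (p - 1) * χ (-1) := by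
    have : ∀ c : ZMod p, χ ((0 : ZMod p) ^ 2 + 4 * c) * χ (-c) = if c = 0 then 0 else χ (-1) := by
      intro c
      split_ifs with hc
      · simp [hc, hχ]
      · rw [zero_pow two_ne_zero, zero_add, map_mul, hχ4, one_mul, neg_eq_neg_one_mul, map_mul,
          mul_left_comm, ← sq, quadraticChar_sq_one hc, mul_one]
    rw [Finset.sum_congr rfl fun c _ => this c, Finset.sum_ite, Finset.sum_const_zero, zero_add,
      Finset.sum_const, Finset.filter_ne' , Finset.card_erase_of_mem (mem_univ _), card_univ,
      ZMod.card, nsmul_eq_mul, Nat.cast_sub (Fact.out : p.Prime).one_le]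
    simp
  rw [← Finset.add_sum_erase _ _ (mem_univ (0 : ZMod p)), h0,
    Finset.sum_congr rfl fun b hb' => hb b (Finset.ne_of_mem_erase hb'), Finset.sum_const,
    Finset.card_erase_of_mem (mem_univ _), card_univ, ZMod.card, nsmul_eq_mul,
    Nat.cast_sub (Fact.out : p.Prime).one_le]
  simp

/-- Write n = p^e·m with e odd and p ∤ m, so that (k/n) = χ_p(k)·(k/m). Translating b and c by
multiples of m fixes the symbol modulo m and runs through all residues modulo p. Averaging over
these translations reduces the sum to the one modulo p. -/
theorem sum_jac_disc_mul {n : ℕ} (hn : n ≠ 0) [NeZero n] (hodd : Odd n) (hsq : ¬ IsSquare n) :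
    ∑ b : ZMod n, ∑ c : ZMod n, jac n (b ^ 2 + 4 * c) * jac n (-c) = 0 := by
  obtain ⟨p, e, m, hp, he, hpm, hnm⟩ := exists_prime_odd_multiplicity hn hsq
  have : Fact p.Prime := ⟨hp⟩
  have hp2 : p ≠ 2 := by
    rintro rfl
    obtain ⟨k, rfl⟩ : 2 ∣ n := hnm ▸ (dvd_pow_self 2 (by rintro rfl; simp at he)).mul_right m
    exact (Nat.not_even_iff_odd.mpr hodd) (even_two_mul k)
  have hm0 : m ≠ 0 := by rintro rfl; simp at hpm
  have hjac : ∀ k : ℤ, jacobiSym k n = quadraticChar (ZMod p) (k : ZMod p) * jacobiSym k m := by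
    intro k
    rw [hnm, jacobiSym.mul_right' k (pow_ne_zero _ hp.ne_zero) hm0, jacobiSym.pow_right,
      ← jacobiSym.legendreSym.to_jacobiSym]
    congr 1
    change (quadraticChar (ZMod p) (k : ZMod p)) ^ e = _
    rcases eq_or_ne (k : ZMod p) 0 with h | h
    · rw [h]; simp; rintro rfl; simp at he
    · rcases quadraticChar_dichotomy h with h | h <;> rw [h]
      · simp
      · exact he.neg_one_pow
  have hmunit : (m : ZMod p) ≠ 0 := by rwa [Ne, ZMod.natCast_eq_zero_iff]
  set F : ZMod n → ZMod n → ℤ := fun b c => jac n (b ^ 2 + 4 * c) * jac n (-c) with hF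
  have inner : ∀ b c : ZMod n, ∑ i : ZMod p, ∑ j : ZMod p,
      F (b + ((m * i.val : ℕ) : ZMod n)) (c + ((m * j.val : ℕ) : ZMod n)) = 0 := by
    intro b c
    obtain ⟨x, rfl⟩ := ZMod.intCast_surjective b
    obtain ⟨y, rfl⟩ := ZMod.intCast_surjective c
    have term : ∀ i j : ZMod p,
        F ((x : ZMod n) + ((m * i.val : ℕ) : ZMod n)) ((y : ZMod n) + ((m * j.val : ℕ) : ZMod n)) =
        (jacobiSym (x ^ 2 + 4 * y) m * jacobiSym (-y) m) *
        (quadraticChar (ZMod p) (((x : ZMod p) + m * i) ^ 2 + 4 * ((y : ZMod p) + m * j)) *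
          quadraticChar (ZMod p) (-((y : ZMod p) + m * j))) := by
      intro i j
      have a1 : ((x : ZMod n) + ((m * i.val : ℕ) : ZMod n)) ^ 2 +
          4 * ((y : ZMod n) + ((m * j.val : ℕ) : ZMod n)) =
          (((x + m * i.val) ^ 2 + 4 * (y + m * j.val) : ℤ) : ZMod n) := by push_cast; ring
      have a2 : -((y : ZMod n) + ((m * j.val : ℕ) : ZMod n)) =
          ((-(y + m * j.val) : ℤ) : ZMod n) := by push_cast; ring
      have b1 : jacobiSym ((x + m * i.val) ^ 2 + 4 * (y + m * j.val)) m =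
          jacobiSym (x ^ 2 + 4 * y) m := by
        apply jacobiSym.mod_left'
        apply Int.ModEq.symm
        rw [Int.modEq_iff_dvd]
        exact ⟨2 * x * i.val + m * i.val ^ 2 + 4 * j.val, by ring⟩
      have b2 : jacobiSym (-(y + m * j.val)) m = jacobiSym (-y) m := by
        apply jacobiSym.mod_left'
        apply Int.ModEq.symm
        rw [Int.modEq_iff_dvd]
        exact ⟨-j.val, by ring⟩
      simp only [hF]
      rw [a1, a2, jac_intCast, jac_intCast, hjac, hjac, b1, b2]
      push_cast
      rw [ZMod.natCast_zmod_val, ZMod.natCast_zmod_val]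
      ring
    simp_rw [term, ← Finset.mul_sum]
    have bij : ∀ z : ℤ, Function.Bijective fun i : ZMod p => (z : ZMod p) + m * i := fun z =>
      ((Equiv.mulLeft₀ (m : ZMod p) hmunit).trans (Equiv.addLeft (z : ZMod p))).bijective
    have s2 : ∀ b : ZMod p, ∑ j : ZMod p,
        quadraticChar (ZMod p) (b ^ 2 + 4 * ((y : ZMod p) + m * j)) *
          quadraticChar (ZMod p) (-((y : ZMod p) + m * j)) =
        ∑ c : ZMod p, quadraticChar (ZMod p) (b ^ 2 + 4 * c) * quadraticChar (ZMod p) (-c) :=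
      fun b => Function.Bijective.sum_comp (bij y) fun c : ZMod p =>
        quadraticChar (ZMod p) (b ^ 2 + 4 * c) * quadraticChar (ZMod p) (-c)
    simp_rw [s2]
    rw [Function.Bijective.sum_comp (bij x) fun b : ZMod p => ∑ c : ZMod p,
      quadraticChar (ZMod p) (b ^ 2 + 4 * c) * quadraticChar (ZMod p) (-c),
      sum_quadraticChar_disc_mul hp2, mul_zero]
  have avg : ∑ i : ZMod p, ∑ j : ZMod p, ∑ b : ZMod n, ∑ c : ZMod n,
      F (b + ((m * i.val : ℕ) : ZMod n)) (c + ((m * j.val : ℕ) : ZMod n)) = 0 := by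
    have : ∀ i : ZMod p, ∑ j : ZMod p, ∑ b : ZMod n, ∑ c : ZMod n,
        F (b + ((m * i.val : ℕ) : ZMod n)) (c + ((m * j.val : ℕ) : ZMod n)) =
        ∑ b : ZMod n, ∑ c : ZMod n, ∑ j : ZMod p,
        F (b + ((m * i.val : ℕ) : ZMod n)) (c + ((m * j.val : ℕ) : ZMod n)) := by
      intro i
      rw [Finset.sum_comm]
      exact Finset.sum_congr rfl fun b _ => Finset.sum_comm
    simp_rw [this]
    rw [Finset.sum_comm]
    refine Finset.sum_eq_zero fun b _ => ?_
    rw [Finset.sum_comm]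
    exact Finset.sum_eq_zero fun c _ => inner b c
  have shift : ∀ u v : ZMod n, ∑ b : ZMod n, ∑ c : ZMod n, F (b + u) (c + v) =
      ∑ b : ZMod n, ∑ c : ZMod n, F b c := by
    intro u v
    have : ∀ b : ZMod n, ∑ c : ZMod n, F b (c + v) = ∑ c : ZMod n, F b c := fun b =>
      Equiv.sum_comp (Equiv.addRight v) (F b)
    simp_rw [this]
    exact Equiv.sum_comp (Equiv.addRight u) fun b => ∑ c : ZMod n, F b c
  simp_rw [shift, Finset.sum_const, card_univ, ZMod.card, nsmul_eq_mul] at avg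
  have hp1 : p ≠ 0 := hp.ne_zero
  simpa [hp1] using avg

/-- The involution c ↦ -c - b²/4 exchanges b² + 4c with -4c, and 4 has symbol 1. -/
theorem sum_jac_swap {n : ℕ} [NeZero n] (hodd : Odd n) :
    ∑ b : ZMod n, ∑ c : ZMod n, jac n (b ^ 2 + 4 * c) ^ 2 * jac n (-c) =
    ∑ b : ZMod n, ∑ c : ZMod n, jac n (b ^ 2 + 4 * c) * jac n (-c) ^ 2 := by
  refine Finset.sum_congr rfl fun b _ => ?_
  obtain ⟨w, hw⟩ := isUnit_four hodd
  have hw1 : (4 : ZMod n) * (↑w⁻¹ : ZMod n) = 1 := by rw [← hw]; exact w.mul_inv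
  have hj4 := jac_four hodd
  let φ : ZMod n ≃ ZMod n := Equiv.subLeft (-(b ^ 2 * (↑w⁻¹ : ZMod n)))
  refine Fintype.sum_equiv φ _ _ fun c => ?_
  have e1 : b ^ 2 + 4 * φ c = 4 * (-c) := by
    simp only [φ, Equiv.subLeft_apply]
    linear_combination (-b ^ 2) * hw1
  have e2 : 4 * (-(φ c)) = b ^ 2 + 4 * c := by
    simp only [φ, Equiv.subLeft_apply]
    linear_combination (b ^ 2) * hw1
  rw [e1, ← e2, jac_mul, jac_mul, hj4]
  ring

theorem four_mul_count {n : ℕ} [NeZero n] (hodd : Odd n) (hsq : ¬ IsSquare n) :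
    4 * ∑ b : ZMod n, ∑ c : ZMod n,
      (if jac n (b ^ 2 + 4 * c) = -1 ∧ jac n (-c) = 1 then 1 else 0 : ℤ) =
    ∑ b : ZMod n, ∑ c : ZMod n, jac n (b ^ 2 + 4 * c) ^ 2 * jac n (-c) ^ 2 := by
  have h : ∀ b c : ZMod n,
      4 * (if jac n (b ^ 2 + 4 * c) = -1 ∧ jac n (-c) = 1 then 1 else 0 : ℤ) =
      jac n (b ^ 2 + 4 * c) ^ 2 * jac n (-c) ^ 2 +
      jac n (b ^ 2 + 4 * c) ^ 2 * jac n (-c) - jac n (b ^ 2 + 4 * c) * jac n (-c) ^ 2 -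
      jac n (b ^ 2 + 4 * c) * jac n (-c) := by
    intro b c
    rcases jac_trichotomy n (b ^ 2 + 4 * c) with h | h | h <;>
      rcases jac_trichotomy n (-c) with h' | h' | h' <;> rw [h, h'] <;> norm_num
  simp_rw [Finset.mul_sum, h, Finset.sum_sub_distrib, Finset.sum_add_distrib]
  rw [sum_jac_swap hodd, sum_jac_disc_mul (NeZero.ne n) hodd hsq]
  ring

theorem sum_zmod_eq_sum_range {n : ℕ} [NeZero n] (f : ZMod n → ℤ) :
    ∑ a : ZMod n, f a = ∑ i ∈ range n, f (i : ZMod n) := by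
  refine Finset.sum_bij' (fun a _ => a.val) (fun i _ => (i : ZMod n)) ?_ ?_ ?_ ?_ ?_
  · intro a _; exact mem_range.mpr (ZMod.val_lt a)
  · intro i _; exact mem_univ _
  · intro a _; exact ZMod.natCast_zmod_val a
  · intro i hi; exact ZMod.val_cast_of_lt (mem_range.mp hi)
  · intro a _; rw [ZMod.natCast_zmod_val]

theorem gcd_nontrivial_of_jacobiSym_eq_zero {n : ℕ} [NeZero n] {k : ℕ}
    (h : jacobiSym (k : ℤ) n = 0) (hk : ¬ n ∣ k) : 1 < Nat.gcd k n ∧ Nat.gcd k n < n := by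
  rw [jacobiSym.eq_zero_iff_not_coprime, Int.gcd_natCast_natCast] at h
  have h0 : 0 < Nat.gcd k n := Nat.gcd_pos_of_pos_right _ (Nat.pos_of_neZero n)
  refine ⟨by omega, lt_of_le_of_ne (Nat.le_of_dvd (Nat.pos_of_neZero n) (Nat.gcd_dvd_right _ _)) ?_⟩
  intro h'
  exact hk (h' ▸ Nat.gcd_dvd_left k n)

open Classical in
-- A pair missed by M(n) either has both symbols nonzero without being admissible, or has n dividing
-- c or the discriminant: any other vanishing symbol produces a nontrivial gcd.
theorem pair_indicator_le {n : ℕ} (hn : 1 < n) (hodd : Odd n) (b c : ℕ) :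
    (1 : ℤ) ≤ (if (Admissible n (b : ℤ) (c : ℤ) ∨
      (1 < Nat.gcd (b ^ 2 + 4 * c) n ∧ Nat.gcd (b ^ 2 + 4 * c) n < n) ∨
      (1 < Nat.gcd c n ∧ Nat.gcd c n < n)) then 1 else 0) +
      (jacobiSym ((b : ℤ) ^ 2 + 4 * c) n ^ 2 * jacobiSym (-(c : ℤ)) n ^ 2 -
        (if jacobiSym ((b : ℤ) ^ 2 + 4 * c) n = -1 ∧ jacobiSym (-(c : ℤ)) n = 1 then 1 else 0)) +
      (if n ∣ c then 1 else 0) + (if n ∣ b ^ 2 + 4 * c then 1 else 0) := by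
  have : NeZero n := ⟨by omega⟩
  have hadm : Admissible n (b : ℤ) (c : ℤ) ↔
    (jacobiSym ((b : ℤ) ^ 2 + 4 * c) n = -1 ∧ jacobiSym (-(c : ℤ)) n = 1) := Iff.rfl
  have hd : ((b ^ 2 + 4 * c : ℕ) : ℤ) = (b : ℤ) ^ 2 + 4 * c := by push_cast; ring
  by_cases hA : Admissible n (b : ℤ) (c : ℤ)
  · rw [if_pos (Or.inl hA), if_pos (hadm.mp hA), (hadm.mp hA).1, (hadm.mp hA).2]
    split_ifs <;> norm_num
  · rw [if_neg (fun h => hA (hadm.mpr h))]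
    have hsq : 0 ≤ jacobiSym ((b : ℤ) ^ 2 + 4 * c) n ^ 2 * jacobiSym (-(c : ℤ)) n ^ 2 := by
      positivity
    by_cases h1 : n ∣ c
    · rw [if_pos h1]; split_ifs <;> linarith
    by_cases h2 : n ∣ b ^ 2 + 4 * c
    · rw [if_pos h2]; split_ifs <;> linarith
    rw [if_neg h1, if_neg h2]
    by_cases z1 : jacobiSym ((b : ℤ) ^ 2 + 4 * c) n = 0
    · rw [if_pos (Or.inr (Or.inl (gcd_nontrivial_of_jacobiSym_eq_zero (hd ▸ z1) h2)))]
      linarith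
    by_cases z2 : jacobiSym (c : ℤ) n = 0
    · rw [if_pos (Or.inr (Or.inr (gcd_nontrivial_of_jacobiSym_eq_zero z2 h1)))]
      linarith
    have z2' : jacobiSym (-(c : ℤ)) n ≠ 0 := by
      rw [jacobiSym.neg _ hodd]
      intro h
      rcases mul_eq_zero.mp h with h | h
      · have h9 := jacobiSym.at_neg_one hodd
        rw [h] at h9
        have := jacobiSym.eq_one_or_neg_one (a := -1) (b := n) (by simp)
        omega
      · exact z2 h
    have q1 : jacobiSym ((b : ℤ) ^ 2 + 4 * c) n ^ 2 = 1 := by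
      rcases jacobiSym.trichotomy ((b : ℤ) ^ 2 + 4 * c) n with h | h | h
      · exact absurd h z1
      all_goals rw [h]; norm_num
    have q2 : jacobiSym (-(c : ℤ)) n ^ 2 = 1 := by
      rcases jacobiSym.trichotomy (-(c : ℤ)) n with h | h | h
      · exact absurd h z2'
      all_goals rw [h]; norm_num
    rw [q1, q2]
    split_ifs <;> norm_num

theorem card_coprime_range_add_three_le {n p : ℕ} (hp : 1 < p) (hpn : p ∣ n) (h3 : 3 * p ≤ n) :
    ((range n).filter fun c => Nat.Coprime n c).card + 3 ≤ n := by
  have hdisj : Disjoint ((range n).filter fun c => Nat.Coprime n c) {0, p, 2 * p} := by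
    rw [Finset.disjoint_left]
    intro c hc hc'
    have hco := (mem_filter.mp hc).2
    have hpc : p ∣ c := by
      simp only [mem_insert, mem_singleton] at hc'
      rcases hc' with rfl | rfl | rfl
      · exact dvd_zero _
      · exact dvd_rfl
      · exact dvd_mul_left _ _
    have := Nat.dvd_gcd hpn hpc
    rw [hco] at this
    exact absurd (Nat.le_of_dvd one_pos this) (by omega)
  have hcard : ({0, p, 2 * p} : Finset ℕ).card = 3 := by
    rw [Finset.card_eq_three]
    exact ⟨0, p, 2 * p, by omega, by omega, by omega, rfl⟩
  rw [← hcard, ← Finset.card_union_of_disjoint hdisj]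
  conv_rhs => rw [← card_range n]
  apply Finset.card_le_card
  intro c hc
  simp only [mem_union, mem_filter, mem_range, mem_insert, mem_singleton] at hc ⊢
  omega

open Classical in
theorem sq_le_four_mul_pairCount {n p : ℕ} (hn : 1 < n) (hodd : Odd n) (hsq : ¬ IsSquare n)
    (hp : 1 < p) (hpn : p ∣ n) (h3 : 3 * p ≤ n) : n ^ 2 ≤ 4 * pairCount n := by
  have : NeZero n := ⟨by omega⟩
  have hcount := four_mul_count hodd hsq
  have e1 : ∀ b c : ℕ, jac n ((b : ZMod n) ^ 2 + 4 * (c : ZMod n)) =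
      jacobiSym ((b : ℤ) ^ 2 + 4 * c) n := by
    intro b c; rw [← jac_intCast]; push_cast; rfl
  have e2 : ∀ c : ℕ, jac n (-(c : ZMod n)) = jacobiSym (-(c : ℤ)) n := by
    intro c; rw [← jac_intCast]; push_cast; rfl
  simp_rw [sum_zmod_eq_sum_range, e1, e2] at hcount
  set A : ℤ := ∑ b ∈ range n, ∑ c ∈ range n,
    (if jacobiSym ((b : ℤ) ^ 2 + 4 * c) n = -1 ∧ jacobiSym (-(c : ℤ)) n = 1 then 1 else 0) with hA
  set U : ℤ := ∑ b ∈ range n, ∑ c ∈ range n,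
    jacobiSym ((b : ℤ) ^ 2 + 4 * c) n ^ 2 * jacobiSym (-(c : ℤ)) n ^ 2 with hU
  have hM : (pairCount n : ℤ) = ∑ b ∈ range n, ∑ c ∈ range n,
      (if (Admissible n (b : ℤ) (c : ℤ) ∨
      (1 < Nat.gcd (b ^ 2 + 4 * c) n ∧ Nat.gcd (b ^ 2 + 4 * c) n < n) ∨
      (1 < Nat.gcd c n ∧ Nat.gcd c n < n)) then 1 else 0) := by
    rw [pairCount, Finset.card_filter, ← Finset.sum_product']
    push_cast
    rfl
  have hC : ∑ b ∈ range n, ∑ c ∈ range n, (if n ∣ c then 1 else 0 : ℤ) ≤ n := by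
    have : ∀ b ∈ range n, ∑ c ∈ range n, (if n ∣ c then 1 else 0 : ℤ) ≤ 1 := by
      intro b _
      rw [← Finset.sum_filter, Finset.sum_const, nsmul_eq_mul, mul_one]
      norm_cast
      rw [Finset.card_le_one]
      intro x hx y hy
      simp only [mem_filter, mem_range] at hx hy
      rw [Nat.eq_zero_of_dvd_of_lt hx.2 hx.1, Nat.eq_zero_of_dvd_of_lt hy.2 hy.1]
    calc _ ≤ ∑ b ∈ range n, (1 : ℤ) := Finset.sum_le_sum this
      _ = n := by simp
  have hD : ∑ b ∈ range n, ∑ c ∈ range n, (if n ∣ b ^ 2 + 4 * c then 1 else 0 : ℤ) ≤ n := by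
    have : ∀ b ∈ range n, ∑ c ∈ range n, (if n ∣ b ^ 2 + 4 * c then 1 else 0 : ℤ) ≤ 1 := by
      intro b _
      rw [← Finset.sum_filter, Finset.sum_const, nsmul_eq_mul, mul_one]
      norm_cast
      rw [Finset.card_le_one]
      intro x hx y hy
      simp only [mem_filter, mem_range] at hx hy
      have h4 : Nat.Coprime n 4 :=
        (Nat.Coprime.pow_right 2 (Nat.coprime_two_right.mpr hodd) : Nat.Coprime n (2 ^ 2))
      have hm : 4 * x ≡ 4 * y [MOD n] := by
        have h1 := (Nat.modEq_zero_iff_dvd.mpr hx.2).trans (Nat.modEq_zero_iff_dvd.mpr hy.2).symm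
        exact Nat.ModEq.add_left_cancel' _ h1
      have := Nat.ModEq.cancel_left_of_coprime h4 hm
      exact Nat.ModEq.eq_of_lt_of_lt this hx.1 hy.1
    calc _ ≤ ∑ b ∈ range n, (1 : ℤ) := Finset.sum_le_sum this
      _ = n := by simp
  -- The multiples 0, p, 2p of p are not coprime to n. Three are needed: M ≥ n² - (3/4)U - 2n, and
  -- (9/4)n outweighs the 2n lost to n ∣ c and n ∣ b² + 4c.
  have hU' : U ≤ n * (n - 3) := by
    have : ∀ b ∈ range n, ∑ c ∈ range n,
        jacobiSym ((b : ℤ) ^ 2 + 4 * c) n ^ 2 * jacobiSym (-(c : ℤ)) n ^ 2 ≤ n - 3 := by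
      intro b _
      have hle : ∀ c ∈ range n,
          jacobiSym ((b : ℤ) ^ 2 + 4 * c) n ^ 2 * jacobiSym (-(c : ℤ)) n ^ 2 ≤
          if Nat.Coprime n c then 1 else 0 := by
        intro c _
        split_ifs with hc
        · rcases jacobiSym.trichotomy ((b : ℤ) ^ 2 + 4 * c) n with h | h | h <;>
            rcases jacobiSym.trichotomy (-(c : ℤ)) n with h' | h' | h' <;> rw [h, h'] <;> norm_num
        · have : jacobiSym (-(c : ℤ)) n = 0 := by
            rw [jacobiSym.eq_zero_iff_not_coprime, Int.neg_gcd, Int.gcd_natCast_natCast,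
              Nat.gcd_comm]
            exact hc
          rw [this]; norm_num
      refine (Finset.sum_le_sum hle).trans ?_
      rw [← Finset.sum_filter, Finset.sum_const, nsmul_eq_mul, mul_one]
      have := card_coprime_range_add_three_le hp hpn h3
      have h' := Int.ofNat_le.mpr this
      push_cast at h'
      linarith
    calc U ≤ ∑ b ∈ range n, ((n : ℤ) - 3) := Finset.sum_le_sum this
      _ = n * (n - 3) := by rw [Finset.sum_const, card_range, nsmul_eq_mul]
  have hsum := Finset.sum_le_sum fun b (_ : b ∈ range n) =>
    Finset.sum_le_sum fun c (_ : c ∈ range n) => pair_indicator_le hn hodd b c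
  simp_rw [Finset.sum_add_distrib, Finset.sum_sub_distrib] at hsum
  rw [← hM, ← hU, ← hA] at hsum
  have hone : ∑ b ∈ range n, ∑ c ∈ range n, (1 : ℤ) = n * n := by simp
  rw [hone] at hsum
  zify
  nlinarith

theorem pairCount_pos {n : ℕ} (hn : 1 < n) (hcomp : ¬ n.Prime) : 0 < pairCount n := by
  classical
  rw [pairCount, Finset.card_pos]
  have hmin := Nat.minFac_prime (n := n) (by omega)
  have hlt : n.minFac < n := (Nat.not_prime_iff_minFac_lt hn).mp hcomp
  refine ⟨(0, n.minFac), ?_⟩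
  rw [mem_filter, mem_product, mem_range, mem_range]
  refine ⟨⟨by simp; omega, hlt⟩, Or.inr (Or.inr ?_)⟩
  rw [Nat.gcd_eq_left (Nat.minFac_dvd n)]
  exact ⟨hmin.one_lt, hlt⟩

/-! ### The test quadratics and the conditions modulo a prime -/

theorem qftPoly_eq (n : ℕ) (b c : ℤ) :
    qftPoly n b c = X ^ 2 - (C (b : ZMod n) * X + C (c : ZMod n)) := by
  rw [qftPoly]; ring

theorem qftPoly_monic (n : ℕ) (b c : ℤ) : (qftPoly n b c).Monic := by
  rw [qftPoly_eq]
  exact monic_X_pow_sub degree_linear_lt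

theorem qftPoly_degree (n : ℕ) [Nontrivial (ZMod n)] (b c : ℤ) : (qftPoly n b c).degree = 2 := by
  rw [qftPoly_eq, degree_sub_eq_left_of_degree_lt, degree_X_pow]
  · rfl
  · rw [degree_X_pow]; exact degree_linear_lt

theorem qftPoly_natDegree (n : ℕ) [Nontrivial (ZMod n)] (b c : ℤ) :
    (qftPoly n b c).natDegree = 2 :=
  natDegree_eq_of_degree_eq_some (qftPoly_degree n b c)

theorem qftPoly_map {n p : ℕ} (h : p ∣ n) (b c : ℤ) :
    (qftPoly n b c).map (ZMod.castHom h (ZMod p)) = qftPoly p b c := by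
  simp [qftPoly]

theorem PassesStep3.dvd {n : ℕ} {b c : ℤ} (h : PassesStep3 n b c) :
    ∃ a : ZMod n, qftPoly n b c ∣ X ^ ((n + 1) / 2) - C a := by
  obtain ⟨a, ha⟩ := h
  refine ⟨a, ?_⟩
  rw [← AdjoinRoot.mk_eq_zero, map_sub, map_pow, AdjoinRoot.mk_X, AdjoinRoot.mk_C, sub_eq_zero]
  exact ha

theorem PassesStep4.dvd {n : ℕ} {b c : ℤ} (h : PassesStep4 n b c) :
    qftPoly n b c ∣ X ^ (n + 1) + C (c : ZMod n) := by
  rw [← AdjoinRoot.mk_eq_zero, map_add, map_pow, AdjoinRoot.mk_X, AdjoinRoot.mk_C, map_intCast]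
  exact eq_neg_iff_add_eq_zero.mp h

theorem PassesStep5.dvd {n : ℕ} {b c : ℤ} (h : PassesStep5 n b c) :
    qftPoly n b c ∣ X ^ sPart n - 1 ∨
      ∃ j : ℕ, j + 2 ≤ rExp n ∧ qftPoly n b c ∣ X ^ (2 ^ j * sPart n) + 1 := by
  rcases h with h | ⟨j, hj, h⟩
  · left
    rw [← AdjoinRoot.mk_eq_zero, map_sub, map_pow, AdjoinRoot.mk_X, map_one, sub_eq_zero]
    exact h
  · right
    refine ⟨j, hj, ?_⟩
    rw [← AdjoinRoot.mk_eq_zero, map_add, map_pow, AdjoinRoot.mk_X, map_one]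
    exact eq_neg_iff_add_eq_zero.mp h

theorem two_pow_rExp_mul_sPart (n : ℕ) : 2 ^ rExp n * sPart n = n ^ 2 - 1 :=
  Nat.mul_div_cancel' pow_padicValNat_dvd

theorem sPart_odd {n : ℕ} (hn : 1 < n) : Odd (sPart n) := by
  rw [← Nat.not_even_iff_odd, even_iff_two_dvd]
  intro h
  have h0 : n ^ 2 - 1 ≠ 0 := by
    have : 1 < n ^ 2 := Nat.one_lt_pow two_ne_zero hn
    omega
  have h1 : 2 ^ (rExp n + 1) ∣ n ^ 2 - 1 := by
    rw [pow_succ, ← two_pow_rExp_mul_sPart n]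
    exact Nat.mul_dvd_mul_left _ h
  exact pow_succ_padicValNat_not_dvd h0 h1

/-- The conditions which the first four steps of the test impose modulo a prime divisor `p` of
`n`. -/
structure LocalPass (p n : ℕ) (b c : ℤ) : Prop where
  const_ne_zero : (c : ZMod p) ≠ 0
  disc_ne_zero : ((b ^ 2 + 4 * c : ℤ) : ZMod p) ≠ 0
  half_dvd : ∃ a : ZMod p, qftPoly p b c ∣ X ^ ((n + 1) / 2) - C a
  full_dvd : qftPoly p b c ∣ X ^ (n + 1) + C (c : ZMod p)

theorem intCast_ne_zero_of_jacobiSym_ne_zero {n p : ℕ} [NeZero n] (hp : p.Prime) (hpn : p ∣ n)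
    {k : ℤ} (h : jacobiSym k n ≠ 0) : (k : ZMod p) ≠ 0 := by
  rw [Ne, ZMod.intCast_zmod_eq_zero_iff_dvd k p]
  intro hk
  apply h
  rw [jacobiSym.eq_zero_iff_not_coprime]
  intro hg
  have := Int.dvd_gcd hk (Int.natCast_dvd_natCast.mpr hpn)
  rw [hg] at this
  exact hp.one_lt.ne' (Nat.dvd_one.mp (by exact_mod_cast this))

theorem PassesQFT.localPass {B n p : ℕ} {b c : ℤ} (h : PassesQFT B n b c) (hp : p.Prime)
    (hpn : p ∣ n) : LocalPass p n b c := by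
  obtain ⟨hn, -, ⟨ha1, ha2⟩, -, -, h3, h4, -⟩ := h
  have : NeZero n := ⟨by omega⟩
  refine ⟨?_, intCast_ne_zero_of_jacobiSym_ne_zero hp hpn (by rw [ha1]; norm_num), ?_, ?_⟩
  · have := intCast_ne_zero_of_jacobiSym_ne_zero hp hpn (k := -c) (by rw [ha2]; norm_num)
    simpa using this
  · obtain ⟨a, ha⟩ := h3.dvd
    refine ⟨ZMod.castHom hpn (ZMod p) a, ?_⟩
    have := Polynomial.map_dvd (ZMod.castHom hpn (ZMod p)) ha
    rw [qftPoly_map] at this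
    simpa using this
  · have := Polynomial.map_dvd (ZMod.castHom hpn (ZMod p)) h4.dvd
    rw [qftPoly_map] at this
    simpa using this

/-- If c = c', the difference is a nonzero constant times X, and X is a unit modulo the quadratic
because c ≠ 0. If c ≠ c', the quadratics divide X^(n+1) + c and X^(n+1) + c', which differ by a
unit. -/
theorem LocalPass.isCoprime {p n : ℕ} [Fact p.Prime] {b c b' c' : ℤ} (h : LocalPass p n b c)
    (h' : LocalPass p n b' c') (hne : ¬ ((b : ZMod p) = b' ∧ (c : ZMod p) = c')) :
    IsCoprime (qftPoly p b c) (qftPoly p b' c') := by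
  by_cases hc : (c : ZMod p) = c'
  · have hb : (b : ZMod p) ≠ b' := fun hb => hne ⟨hb, hc⟩
    have hb' : (b' : ZMod p) - b ≠ 0 := sub_ne_zero.mpr hb.symm
    have hX : qftPoly p b c - qftPoly p b' c' = C ((b' : ZMod p) - b) * X := by
      rw [qftPoly, qftPoly, hc, C_sub]; ring
    have hc1 : C ((c : ZMod p)⁻¹) * C (c : ZMod p) = 1 := by
      rw [← C_mul, inv_mul_cancel₀ h.const_ne_zero, C_1]
    have hb1 : C (((b' : ZMod p) - b)⁻¹) * C ((b' : ZMod p) - b) = 1 := by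
      rw [← C_mul, inv_mul_cancel₀ hb', C_1]
    set D := C (((b' : ZMod p) - b)⁻¹) with hD
    set I := C ((c : ZMod p)⁻¹) with hI
    have hX' : D * (qftPoly p b c - qftPoly p b' c') = X := by
      rw [hX, ← mul_assoc, hb1, one_mul]
    have hq : qftPoly p b c = X * (X - C (b : ZMod p)) - C (c : ZMod p) := by rw [qftPoly]; ring
    refine ⟨I * (X - C (b : ZMod p)) * D - I, -(I * (X - C (b : ZMod p)) * D), ?_⟩
    linear_combination (I * (X - C (b : ZMod p))) * hX' - I * hq + hc1
  · have hc' : (c : ZMod p) - c' ≠ 0 := sub_ne_zero.mpr hc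
    obtain ⟨u, hu⟩ := h.full_dvd
    obtain ⟨w, hw⟩ := h'.full_dvd
    have hc1 : C (((c : ZMod p) - c')⁻¹) * (C (c : ZMod p) - C (c' : ZMod p)) = 1 := by
      rw [← C_sub, ← C_mul, inv_mul_cancel₀ hc', C_1]
    refine ⟨C (((c : ZMod p) - c')⁻¹) * u, -(C (((c : ZMod p) - c')⁻¹) * w), ?_⟩
    linear_combination C (((c : ZMod p) - c')⁻¹) * (hw - hu) + hc1

theorem two_mul_card_le_natDegree {p n : ℕ} [Fact p.Prime] (S : Finset (ℕ × ℕ))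
    (hS : ∀ q ∈ S, q.1 < p ∧ q.2 < p ∧ LocalPass p n q.1 q.2) {g : (ZMod p)[X]} (hg : g ≠ 0)
    (hdvd : ∀ q ∈ S, qftPoly p q.1 q.2 ∣ g) : 2 * S.card ≤ g.natDegree := by
  have hcop : (S : Set (ℕ × ℕ)).Pairwise
      (Function.onFun IsCoprime fun q : ℕ × ℕ => qftPoly p q.1 q.2) := by
    intro q hq q' hq' hne
    obtain ⟨h1, h2, h3⟩ := hS q hq
    obtain ⟨h1', h2', h3'⟩ := hS q' hq'
    refine h3.isCoprime h3' fun h => hne ?_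
    have key : ∀ {x y : ℕ}, x < p → y < p → (((x : ℕ) : ℤ) : ZMod p) = ((y : ℕ) : ℤ) → x = y := by
      intro x y hx hy hxy
      rw [Int.cast_natCast, Int.cast_natCast, ZMod.natCast_eq_natCast_iff] at hxy
      exact Nat.ModEq.eq_of_lt_of_lt hxy hx hy
    exact Prod.ext (key h1 h1' h.1) (key h2 h2' h.2)
  have hprod := Finset.prod_dvd_of_coprime hcop hdvd
  have := natDegree_le_of_dvd hprod hg
  rw [natDegree_prod_of_monic _ _ fun q _ => qftPoly_monic p _ _,
    Finset.sum_congr rfl fun q _ => qftPoly_natDegree p q.1 q.2, Finset.sum_const, smul_eq_mul]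
    at this
  omega

/-- Squaring step 3 gives x^(n+1) = a², while step 4 gives -c. A quadratic divides no nonzero
constant, so the two agree. -/
theorem LocalPass.isSquare_neg {p n : ℕ} [Fact p.Prime] (hn : Odd n) {b c : ℤ}
    (h : LocalPass p n b c) : ∃ a : ZMod p, a ≠ 0 ∧ a ^ 2 = -(c : ZMod p) := by
  obtain ⟨a, ha⟩ := h.half_dvd
  have h2 : (n + 1) / 2 * 2 = n + 1 := by
    obtain ⟨k, rfl⟩ := hn; omega
  have h1 : qftPoly p b c ∣ X ^ (n + 1) - C (a ^ 2) := by
    have := ha.trans (sub_dvd_pow_sub_pow _ _ 2)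
    rwa [← pow_mul, h2, ← C_pow] at this
  have h3 : qftPoly p b c ∣ C ((c : ZMod p) + a ^ 2) := by
    have := dvd_sub h.full_dvd h1
    rwa [show X ^ (n + 1) + C (c : ZMod p) - (X ^ (n + 1) - C (a ^ 2)) = C ((c : ZMod p) + a ^ 2) by
      rw [C_add]; ring] at this
  have h4 : (c : ZMod p) + a ^ 2 = 0 := by
    by_contra hne
    have := degree_le_of_dvd h3 (C_ne_zero.mpr hne)
    rw [qftPoly_degree, degree_C hne] at this
    exact absurd this (by norm_num)
  have h5 : a ^ 2 = -(c : ZMod p) := by linear_combination h4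
  refine ⟨a, ?_, h5⟩
  rintro rfl
  apply h.const_ne_zero
  simpa using h5.symm

/-- The quadratic splits into two distinct linear factors with nonzero roots, each killed by
Fermat's little theorem. -/
theorem LocalPass.dvd_of_isSquare_disc {p n : ℕ} [Fact p.Prime] (hp : p ≠ 2) {b c : ℤ}
    (h : LocalPass p n b c) (hsq : IsSquare ((b ^ 2 + 4 * c : ℤ) : ZMod p)) :
    qftPoly p b c ∣ X ^ (p - 1) - 1 := by
  obtain ⟨d, hd⟩ := hsq
  have h2 : (2 : ZMod p) ≠ 0 := Ring.two_ne_zero (by rwa [ZMod.ringChar_zmod_n])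
  have hd0 : d ≠ 0 := by
    rintro rfl
    exact h.disc_ne_zero (by simpa using hd)
  push_cast at hd
  set r := ((b : ZMod p) + d) / 2 with hr
  set r' := ((b : ZMod p) - d) / 2 with hr'
  have hsum : r + r' = b := by rw [hr, hr']; field_simp; ring
  have hmul : r * r' = -c := by
    rw [hr, hr']; field_simp; linear_combination hd
  have hfac : qftPoly p b c = (X - C r) * (X - C r') := by
    have e : (C r + C r' : (ZMod p)[X]) = C (b : ZMod p) := by rw [← C_add, hsum]
    have e' : (C r * C r' : (ZMod p)[X]) = -C (c : ZMod p) := by rw [← C_mul, hmul, C_neg]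
    rw [qftPoly]
    linear_combination X * e - e'
  have hne : r - r' ≠ 0 := by
    have : r - r' = d := by rw [hr, hr']; field_simp; ring
    rwa [this]
  have hr0 : r * r' ≠ 0 := by rw [hmul]; exact neg_ne_zero.mpr h.const_ne_zero
  have hdvd : ∀ z : ZMod p, z ≠ 0 → X - C z ∣ X ^ (p - 1) - (1 : (ZMod p)[X]) := by
    intro z hz
    rw [dvd_iff_isRoot, IsRoot, eval_sub, eval_pow, eval_X, eval_one,
      ZMod.pow_card_sub_one_eq_one hz, sub_self]
  rw [hfac]
  exact (isCoprime_X_sub_C_of_isUnit_sub hne.isUnit).mul_dvd (hdvd _ (left_ne_zero_of_mul hr0))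
    (hdvd _ (right_ne_zero_of_mul hr0))

theorem qftPoly_irreducible {p : ℕ} [Fact p.Prime] {b c : ℤ}
    (hsq : ¬ IsSquare ((b ^ 2 + 4 * c : ℤ) : ZMod p)) : Irreducible (qftPoly p b c) := by
  rw [(qftPoly_monic p b c).irreducible_iff_roots_eq_zero_of_degree_le_three
    (by rw [qftPoly_natDegree]) (by rw [qftPoly_natDegree]; norm_num)]
  rw [Multiset.eq_zero_iff_forall_notMem]
  intro z hz
  have hz' := (mem_roots'.mp hz).2
  rw [IsRoot, qftPoly, eval_sub, eval_sub, eval_mul, eval_C, eval_C, eval_pow, eval_X] at hz'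
  apply hsq
  refine ⟨2 * z - b, ?_⟩
  push_cast
  linear_combination (-4) * hz'

/-! ### Frobenius and orders of roots at inert primes -/

section Frobenius

variable {p : ℕ} [Fact p.Prime] {L : Type*} [Field L] [Algebra (ZMod p) L]

/-- By Euler's criterion Frobenius negates 2x - b, a square root of the discriminant. So x^p = b - x
is the conjugate root, and x^(p+1) is the norm. -/
theorem pow_succ_eq_neg_of_quadratic (hp : p ≠ 2) {b c : ZMod p}
    (hsq : ¬ IsSquare (b ^ 2 + 4 * c)) {x : L}
    (hx : x ^ 2 = algebraMap _ L b * x + algebraMap _ L c) :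
    x ^ (p + 1) = -algebraMap _ L c := by
  have hpr : p.Prime := Fact.out
  have : CharP L p := charP_of_injective_algebraMap (algebraMap (ZMod p) L).injective p
  have h2 : (2 : ZMod p) ≠ 0 := Ring.two_ne_zero (by rwa [ZMod.ringChar_zmod_n])
  have h2L : (2 : L) ≠ 0 := by
    have := (map_ne_zero (algebraMap (ZMod p) L)).mpr h2
    rwa [map_ofNat] at this
  have hodd : p / 2 * 2 + 1 = p := by
    have := hpr.eq_two_or_odd
    omega
  have hD0 : b ^ 2 + 4 * c ≠ 0 := fun h => hsq (h ▸ IsSquare.zero)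
  have hE : (b ^ 2 + 4 * c) ^ (p / 2) = -1 := by
    rcases ZMod.pow_div_two_eq_neg_one_or_one p hD0 with h | h
    · exact absurd ((ZMod.euler_criterion p hD0).mpr h) hsq
    · exact h
  set y : L := 2 * x - algebraMap _ L b with hy
  have hy2 : y ^ 2 = algebraMap _ L (b ^ 2 + 4 * c) := by
    rw [hy, map_add, map_pow, map_mul, map_ofNat]
    linear_combination 4 * hx
  have hyp : y ^ p = -y := by
    conv_lhs => rw [← hodd, pow_succ, mul_comm (p / 2) 2, pow_mul, hy2, ← map_pow, hE]
    simp
  have hyp' : y ^ p = 2 * x ^ p - algebraMap _ L b := by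
    have e2 : (2 : L) ^ p = 2 := by
      have := congrArg (algebraMap (ZMod p) L) (ZMod.pow_card (2 : ZMod p))
      rwa [map_pow, map_ofNat] at this
    rw [hy, sub_pow_char, mul_pow, e2, ← map_pow, ZMod.pow_card]
  have hxp : x ^ p = algebraMap _ L b - x := by
    apply mul_left_cancel₀ h2L
    linear_combination hyp - hyp' + hy
  rw [pow_succ, hxp]
  linear_combination -hx

/-- The norm a² of x is killed by (p - 1)/2, because a^(p-1) = 1. This is the extra factor 2 that
step 3 buys. -/
theorem pow_half_card_eq_one (hp : p ≠ 2) {a c : ZMod p} (ha : a ≠ 0) (hac : a ^ 2 = -c) {x : L}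
    (hx : x ^ (p + 1) = -algebraMap _ L c) : x ^ ((p ^ 2 - 1) / 2) = 1 := by
  have hpr : p.Prime := Fact.out
  obtain ⟨k, hk⟩ : ∃ k, p = 2 * k + 1 := hpr.odd_of_ne_two hp
  have e : (p ^ 2 - 1) / 2 = (p + 1) * k := by
    have : p ^ 2 = 2 * ((p + 1) * k) + 1 := by rw [hk]; ring
    omega
  rw [e, pow_mul, hx, ← map_neg, ← hac, ← map_pow, ← pow_mul, show 2 * k = p - 1 by omega,
    ZMod.pow_card_sub_one_eq_one ha, map_one]

/-- Comparing the two powers gives (x^m)^p = x^p, and Frobenius is injective. -/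
theorem pow_cofactor_sub_one_eq_one {c : ZMod p} {x : L} (hx0 : x ≠ 0) {m : ℕ} (hm : 0 < m)
    (hx : x ^ (p + 1) = -algebraMap _ L c) (hxn : x ^ (p * m + 1) = -algebraMap _ L c) :
    x ^ (m - 1) = 1 := by
  have : CharP L p := charP_of_injective_algebraMap (algebraMap (ZMod p) L).injective p
  have h1 : (x ^ m) ^ p = x ^ p := by
    apply mul_right_cancel₀ hx0
    rw [← pow_mul, mul_comm m p, ← pow_succ, ← pow_succ, hx, hxn]
  have h2 : x ^ m = x := frobenius_inj L p h1
  apply mul_right_cancel₀ hx0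
  rw [← pow_succ, Nat.sub_add_cancel hm, h2, one_mul]

end Frobenius

theorem pow_odd_part_eq_one {L : Type*} [Field L] {x : L} {s t v : ℕ} (hs : Odd s)
    (h1 : x ^ s = 1) (h2 : x ^ (2 ^ v * t) = 1) : x ^ t = 1 := by
  rw [← orderOf_dvd_iff_pow_eq_one] at *
  have : Nat.Coprime (orderOf x) (2 ^ v) :=
    Nat.Coprime.coprime_dvd_left h1 (Nat.Coprime.pow_right v (Nat.coprime_two_right.mpr hs))
  exact this.dvd_of_dvd_mul_left h2

/-- For z = x^(2^j·t), z^s = -1 with s odd, while the order of z is a power of 2. Hence z² = 1, and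
z ≠ 1. The point is that the global odd exponent s may be replaced by the local one t without
changing j. -/
theorem pow_two_pow_mul_odd_part_eq_neg_one {L : Type*} [Field L] (hL : (2 : L) ≠ 0) {x : L}
    {s t v j : ℕ} (hs : Odd s) (ht : Odd t) (h1 : x ^ (2 ^ j * s) = -1)
    (h2 : x ^ (2 ^ v * t) = 1) : j < v ∧ x ^ (2 ^ j * t) = -1 := by
  have hne : (-1 : L) ≠ 1 := fun h => hL (by linear_combination -h)
  set z := x ^ (2 ^ j * t) with hz
  have hzs : z ^ s = -1 := by
    rw [hz, ← pow_mul, mul_right_comm, pow_mul, h1, ht.neg_one_pow]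
  have hjv : j < v := by
    by_contra! hle
    obtain ⟨d, rfl⟩ := Nat.exists_eq_add_of_le hle
    apply hne
    rw [← hzs, hz, ← pow_mul, show 2 ^ (v + d) * t * s = 2 ^ v * t * (2 ^ d * s) by ring, pow_mul,
      h2, one_pow]
  refine ⟨hjv, ?_⟩
  have hz2 : orderOf z ∣ 2 ^ (v - j) := by
    rw [orderOf_dvd_iff_pow_eq_one, hz, ← pow_mul,
      show 2 ^ j * t * 2 ^ (v - j) = 2 ^ (j + (v - j)) * t by rw [pow_add]; ring,
      Nat.add_sub_cancel' hjv.le, h2]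
  have hzs2 : orderOf z ∣ 2 * s := by
    rw [orderOf_dvd_iff_pow_eq_one, mul_comm, pow_mul, hzs]; norm_num
  have hco : Nat.Coprime (orderOf z) s :=
    Nat.Coprime.coprime_dvd_left hz2 (Nat.Coprime.pow_left _ (Nat.coprime_two_left.mpr hs))
  have hzz : z ^ 2 = 1 := by
    rw [← orderOf_dvd_iff_pow_eq_one]
    exact hco.dvd_of_dvd_mul_right hzs2
  rcases mul_self_eq_one_iff.mp (sq z ▸ hzz) with h | h
  · exact absurd (by rw [← hzs, h, one_pow]) hne
  · exact h

theorem root_sq (p : ℕ) (b c : ℤ) : AdjoinRoot.root (qftPoly p b c) ^ 2 =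
    algebraMap (ZMod p) _ (b : ZMod p) * AdjoinRoot.root (qftPoly p b c) +
      algebraMap (ZMod p) _ (c : ZMod p) := by
  have h : AdjoinRoot.mk (qftPoly p b c) (X ^ 2 - (C (b : ZMod p) * X + C (c : ZMod p))) = 0 := by
    rw [← qftPoly_eq, AdjoinRoot.mk_self]
  rw [map_sub, map_add, map_mul, map_pow, AdjoinRoot.mk_X, AdjoinRoot.mk_C, AdjoinRoot.mk_C,
    sub_eq_zero] at h
  exact h

theorem dvd_X_pow_sub_one_iff {p m : ℕ} {b c : ℤ} : qftPoly p b c ∣ X ^ m - 1 ↔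
    AdjoinRoot.root (qftPoly p b c) ^ m = 1 := by
  rw [← AdjoinRoot.mk_eq_zero, map_sub, map_pow, AdjoinRoot.mk_X, map_one, sub_eq_zero]

theorem dvd_X_pow_add_one_iff {p m : ℕ} {b c : ℤ} : qftPoly p b c ∣ X ^ m + 1 ↔
    AdjoinRoot.root (qftPoly p b c) ^ m = -1 := by
  rw [← AdjoinRoot.mk_eq_zero, map_add, map_pow, AdjoinRoot.mk_X, map_one, eq_neg_iff_add_eq_zero]

section Minus

variable {p n : ℕ} [Fact p.Prime] {b c : ℤ}

theorem root_pow_succ (hp : p ≠ 2) (hsq : ¬ IsSquare ((b ^ 2 + 4 * c : ℤ) : ZMod p)) :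
    AdjoinRoot.root (qftPoly p b c) ^ (p + 1) = -algebraMap (ZMod p) _ (c : ZMod p) := by
  have : Fact (Irreducible (qftPoly p b c)) := ⟨qftPoly_irreducible hsq⟩
  exact pow_succ_eq_neg_of_quadratic hp (by push_cast at hsq; exact hsq) (root_sq p b c)

theorem LocalPass.dvd_of_not_isSquare_disc (hp : p ≠ 2) (hn : Odd n) (h : LocalPass p n b c)
    (hsq : ¬ IsSquare ((b ^ 2 + 4 * c : ℤ) : ZMod p)) :
    qftPoly p b c ∣ X ^ ((p ^ 2 - 1) / 2) - 1 := by
  have : Fact (Irreducible (qftPoly p b c)) := ⟨qftPoly_irreducible hsq⟩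
  obtain ⟨a, ha, hac⟩ := h.isSquare_neg hn
  exact dvd_X_pow_sub_one_iff.mpr (pow_half_card_eq_one hp ha hac (root_pow_succ hp hsq))

theorem X_pow_sub_one_dvd {R : Type*} [CommRing R] {a m : ℕ} (h : a ∣ m) :
    (X ^ a - 1 : R[X]) ∣ X ^ m - 1 := by
  obtain ⟨k, rfl⟩ := h
  have := sub_dvd_pow_sub_pow (X ^ a : R[X]) 1 k
  rwa [one_pow, ← pow_mul] at this

theorem LocalPass.dvd_X_pow_card_sub_one (hp : p ≠ 2) (hn : Odd n) (h : LocalPass p n b c) :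
    qftPoly p b c ∣ X ^ (p ^ 2 - 1) - 1 := by
  by_cases hsq : IsSquare ((b ^ 2 + 4 * c : ℤ) : ZMod p)
  · refine (h.dvd_of_isSquare_disc hp hsq).trans (X_pow_sub_one_dvd ?_)
    exact ⟨p + 1, by rw [mul_comm, ← Nat.sq_sub_sq, one_pow]⟩
  · refine (h.dvd_of_not_isSquare_disc hp hn hsq).trans (X_pow_sub_one_dvd ?_)
    obtain ⟨k, rfl⟩ : ∃ k, p = 2 * k + 1 := (Fact.out : p.Prime).odd_of_ne_two hp
    refine Nat.div_dvd_of_dvd ⟨2 * k ^ 2 + 2 * k, ?_⟩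
    have : (2 * k + 1) ^ 2 = 2 * (2 * k ^ 2 + 2 * k) + 1 := by ring
    omega

theorem LocalPass.dvd_X_pow_gcd_sub_one (hp : p ≠ 2) {m : ℕ} (hm : 0 < m) (hn : Odd n)
    (hpm : n = p * m) (h : LocalPass p n b c)
    (hsq : ¬ IsSquare ((b ^ 2 + 4 * c : ℤ) : ZMod p)) :
    qftPoly p b c ∣ X ^ Nat.gcd (p ^ 2 - 1) (m - 1) - 1 := by
  have : Fact (Irreducible (qftPoly p b c)) := ⟨qftPoly_irreducible hsq⟩
  have hx := root_pow_succ hp hsq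
  have hx0 : AdjoinRoot.root (qftPoly p b c) ≠ 0 := by
    intro h0
    rw [h0, zero_pow (Nat.succ_ne_zero p), zero_eq_neg] at hx
    exact h.const_ne_zero ((map_eq_zero _).mp hx)
  have hfull : AdjoinRoot.root (qftPoly p b c) ^ (p * m + 1) =
      -algebraMap (ZMod p) _ (c : ZMod p) := by
    have := h.full_dvd
    rw [← AdjoinRoot.mk_eq_zero, map_add, map_pow, AdjoinRoot.mk_X, AdjoinRoot.mk_C, hpm] at this
    exact eq_neg_iff_add_eq_zero.mpr this
  exact dvd_X_pow_sub_one_iff.mpr (pow_gcd_eq_one.mpr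
    ⟨dvd_X_pow_sub_one_iff.mp (h.dvd_X_pow_card_sub_one hp hn),
    pow_cofactor_sub_one_eq_one hx0 hm hx hfull⟩)

theorem LocalPass.dvd_of_odd_order (hp : p ≠ 2) (hn : Odd n) (h : LocalPass p n b c)
    (hsq : ¬ IsSquare ((b ^ 2 + 4 * c : ℤ) : ZMod p)) {s t v : ℕ} (hs : Odd s)
    (hv : (p ^ 2 - 1) / 2 = 2 ^ v * t) (hdvd : qftPoly p b c ∣ X ^ s - 1) :
    qftPoly p b c ∣ X ^ t - 1 := by
  have : Fact (Irreducible (qftPoly p b c)) := ⟨qftPoly_irreducible hsq⟩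
  have h1 := dvd_X_pow_sub_one_iff.mp (h.dvd_of_not_isSquare_disc hp hn hsq)
  rw [hv] at h1
  exact dvd_X_pow_sub_one_iff.mpr (pow_odd_part_eq_one hs (dvd_X_pow_sub_one_iff.mp hdvd) h1)

theorem LocalPass.dvd_of_even_order (hp : p ≠ 2) (hn : Odd n) (h : LocalPass p n b c)
    (hsq : ¬ IsSquare ((b ^ 2 + 4 * c : ℤ) : ZMod p)) {s t v j : ℕ} (hs : Odd s) (ht : Odd t)
    (hv : (p ^ 2 - 1) / 2 = 2 ^ v * t) (hdvd : qftPoly p b c ∣ X ^ (2 ^ j * s) + 1) :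
    j < v ∧ qftPoly p b c ∣ X ^ (2 ^ j * t) + 1 := by
  have : Fact (Irreducible (qftPoly p b c)) := ⟨qftPoly_irreducible hsq⟩
  have h1 := dvd_X_pow_sub_one_iff.mp (h.dvd_of_not_isSquare_disc hp hn hsq)
  rw [hv] at h1
  have h2 : (2 : ZMod p) ≠ 0 := Ring.two_ne_zero (by rwa [ZMod.ringChar_zmod_n])
  have h2L : (2 : AdjoinRoot (qftPoly p b c)) ≠ 0 := by
    have := (map_ne_zero (algebraMap (ZMod p) (AdjoinRoot (qftPoly p b c)))).mpr h2
    rwa [map_ofNat] at this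
  have := pow_two_pow_mul_odd_part_eq_neg_one h2L hs ht (dvd_X_pow_add_one_iff.mp hdvd) h1
  exact ⟨this.1, dvd_X_pow_add_one_iff.mpr this.2⟩

end Minus

/-! ### Unique lifting, for n that is not squarefree -/

theorem PassesQFT.dvd_X_pow_sub_one {B n : ℕ} {b c : ℤ} (h : PassesQFT B n b c) :
    qftPoly n b c ∣ X ^ (n ^ 2 - 1) - 1 := by
  obtain ⟨hn, -, -, -, -, -, -, h5⟩ := h
  rw [← two_pow_rExp_mul_sPart]
  rcases h5.dvd with h | ⟨j, hj, h⟩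
  · exact h.trans (X_pow_sub_one_dvd (dvd_mul_left _ _))
  · have h1 : qftPoly n b c ∣ X ^ (2 ^ (j + 1) * sPart n) - 1 := by
      refine h.trans ⟨X ^ (2 ^ j * sPart n) - 1, ?_⟩
      rw [pow_succ, mul_right_comm, pow_mul]
      ring
    exact h1.trans (X_pow_sub_one_dvd (Nat.mul_dvd_mul_right (pow_dvd_pow 2 (by omega)) _))

/-- Uniqueness of lifts along the square-zero ideal `(m)` of `ZMod n`. -/
theorem qftPoly_lift_unique {n m : ℕ} (hn : 1 < n) (hm : n ∣ m ^ 2) {b c b' c' : ℤ}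
    (h : qftPoly n b c ∣ X ^ (n ^ 2 - 1) - 1) (h' : qftPoly n b' c' ∣ X ^ (n ^ 2 - 1) - 1)
    (hb : (m : ℤ) ∣ b - b') (hc : (m : ℤ) ∣ c - c') :
    (b : ZMod n) = b' ∧ (c : ZMod n) = c' := by
  have : Fact (1 < n) := ⟨hn⟩
  have hN : 0 < n ^ 2 - 1 := by
    have : 1 < n ^ 2 := Nat.one_lt_pow two_ne_zero hn
    omega
  obtain ⟨β, hβ⟩ := hb
  obtain ⟨γ, hγ⟩ := hc
  obtain ⟨G, hG⟩ := h'
  set F := qftPoly n b c with hF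
  set F' := qftPoly n b' c' with hF'
  have hm0 : (C (m : ZMod n) : (ZMod n)[X]) * C (m : ZMod n) = 0 := by
    rw [← C_mul, ← Nat.cast_mul, ← sq, (ZMod.natCast_eq_zero_iff _ _).mpr hm, C_0]
  have hdiff : F' - F = C (m : ZMod n) * (C (β : ZMod n) * X + C (γ : ZMod n)) := by
    have e1 : (C (b : ZMod n) - C (b' : ZMod n)) = C (m : ZMod n) * C (β : ZMod n) := by
      rw [← C_sub, ← C_mul]
      have := congrArg (Int.cast : ℤ → ZMod n) hβ
      push_cast at this; rw [this]
    have e2 : (C (c : ZMod n) - C (c' : ZMod n)) = C (m : ZMod n) * C (γ : ZMod n) := by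
      rw [← C_sub, ← C_mul]
      have := congrArg (Int.cast : ℤ → ZMod n) hγ
      push_cast at this; rw [this]
    rw [hF, hF', qftPoly, qftPoly]
    linear_combination X * e1 + e2
  have hNn : (((n ^ 2 - 1 : ℕ) : ZMod n)) = -1 := by
    rw [Nat.cast_sub (by omega)]; simp
  -- Separability in disguise: n² - 1 is -1 modulo n, so the derivative of X^(n²-1) - 1 is minus a
  -- power of X, a unit modulo F.
  have hder : derivative F' * G + F' * derivative G = -X ^ (n ^ 2 - 1 - 1) := by
    have := congrArg derivative hG
    rw [derivative_sub, derivative_one, derivative_X_pow, derivative_mul, sub_zero, hNn] at this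
    rw [← this]; simp
  -- Put δ = F' - F, so δ² = 0. Modulo F, F' ≡ δ and F'G ≡ 0, hence δG ≡ 0 and δF' ≡ 0. Multiplying
  -- the derivative identity by δ kills its left side, so F divides δ times a power of X, and
  -- therefore δ, whose degree is below 2.
  have key : F ∣ F' - F := by
    have hX : F ∣ X ^ (n ^ 2 - 1) * (F' - F) := by
      have hpow : (X : (ZMod n)[X]) ^ (n ^ 2 - 1) = X * X ^ (n ^ 2 - 1 - 1) := by
        rw [← pow_succ', Nat.sub_add_cancel hN]
      have hsq : (F' - F) * (F' - F) = 0 := by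
        rw [hdiff]
        linear_combination (C (β : ZMod n) * X + C (γ : ZMod n)) ^ 2 * hm0
      have e : X ^ (n ^ 2 - 1) * (F' - F) =
          F * (X * G * derivative F' - X * (F' - F) * derivative G) -
            (X ^ (n ^ 2 - 1) - 1) * (X * derivative F') := by
        rw [hG]
        linear_combination (F' - F) * hpow + X * (F' - F) * hder - X * derivative G * hsq
      rw [e]
      exact dvd_sub (dvd_mul_right _ _) (h.mul_right _)
    have := dvd_sub hX (h.mul_right (F' - F))
    rwa [show X ^ (n ^ 2 - 1) * (F' - F) - (X ^ (n ^ 2 - 1) - 1) * (F' - F) = F' - F by ring]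
      at this
  have hlin : F' - F = C ((b : ZMod n) - b') * X + C ((c : ZMod n) - c') := by
    rw [hF, hF', qftPoly, qftPoly, C_sub, C_sub]; ring
  have hzero : C ((b : ZMod n) - b') * X + C ((c : ZMod n) - c') = 0 := by
    rw [hlin] at key
    by_contra hne
    exact (qftPoly_monic n b c).not_dvd_of_degree_lt hne
      (by rw [qftPoly_degree]; exact degree_linear_lt) key
  have hcoeff : ∀ u v : ZMod n, C u * X + C v = 0 → u = 0 ∧ v = 0 := by
    intro u v h
    refine ⟨?_, ?_⟩
    · simpa using congrArg (fun q => coeff q 1) h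
    · simpa using congrArg (fun q => coeff q 0) h
  have := hcoeff _ _ hzero
  exact ⟨sub_eq_zero.mp this.1, sub_eq_zero.mp this.2⟩

theorem passCount_le_sq {B n m : ℕ} (hm : n ∣ m ^ 2) (hm0 : 0 < m) :
    passCount B n ≤ m ^ 2 := by
  classical
  rw [passCount, sq m]
  conv_rhs => rw [← card_range m, ← card_product]
  refine Finset.card_le_card_of_injOn (fun q => (q.1 % m, q.2 % m)) ?_ ?_
  · intro q _
    simp only [coe_product, coe_range, Set.mem_prod, Set.mem_Iio]
    exact ⟨Nat.mod_lt _ hm0, Nat.mod_lt _ hm0⟩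
  · intro q hq q' hq' he
    rw [mem_coe, mem_filter, mem_product, mem_range, mem_range] at hq hq'
    obtain ⟨⟨hq1, hq2⟩, hp⟩ := hq
    obtain ⟨⟨hq1', hq2'⟩, hp'⟩ := hq'
    simp only [Prod.mk.injEq] at he
    have h := qftPoly_lift_unique hp.1 hm hp.dvd_X_pow_sub_one hp'.dvd_X_pow_sub_one
      (Int.modEq_iff_dvd.mp (Int.natCast_modEq_iff.mpr (show q'.1 ≡ q.1 [MOD m] from he.1.symm)))
      (Int.modEq_iff_dvd.mp (Int.natCast_modEq_iff.mpr (show q'.2 ≡ q.2 [MOD m] from he.2.symm)))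
    rw [Int.cast_natCast, Int.cast_natCast, Int.cast_natCast, Int.cast_natCast,
      ZMod.natCast_eq_natCast_iff, ZMod.natCast_eq_natCast_iff] at h
    exact Prod.ext (Nat.ModEq.eq_of_lt_of_lt h.1 hq1 hq1') (Nat.ModEq.eq_of_lt_of_lt h.2 hq2 hq2')

/-- If some prime factor were at most B, then so would be the least one, which is also at most √n
for composite n. Trial division would find it. -/
theorem PassesQFT.lt_prime {B n p : ℕ} {b c : ℤ} (h : PassesQFT B n b c) (hcomp : ¬ n.Prime)
    (hp : p.Prime) (hpn : p ∣ n) : B < p := by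
  obtain ⟨hn, -, -, h1, -⟩ := h
  by_contra! hle
  have hmin : n.minFac ≤ p := Nat.minFac_le_of_dvd hp.two_le hpn
  refine h1 n.minFac (Nat.minFac_prime (by omega)) ?_ (Nat.minFac_dvd n)
  refine le_min (by exact_mod_cast hmin.trans hle) (Real.le_sqrt_of_sq_le ?_)
  exact_mod_cast Nat.minFac_sq_le_self (by omega) hcomp

/-! ### Chinese remainder counting for squarefree n -/

theorem card_le_prod_card_image {n : ℕ} (hn : Squarefree n) {S : Finset (ℕ × ℕ)}
    (hS : S ⊆ range n ×ˢ range n) :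
    S.card ≤ ∏ p ∈ n.primeFactors, (S.image fun q => (q.1 % p, q.2 % p)).card := by
  rw [← Finset.card_pi]
  refine Finset.card_le_card_of_injOn (fun q => fun p _ => (q.1 % p, q.2 % p)) ?_ ?_
  · intro q hq
    rw [mem_coe, Finset.mem_pi]
    intro p _
    exact mem_image_of_mem _ hq
  · intro q hq q' hq' he
    have hq := mem_product.mp (hS hq)
    have hq' := mem_product.mp (hS hq')
    rw [mem_range, mem_range] at hq hq'
    have he' : ∀ p ∈ n.primeFactors, q.1 % p = q'.1 % p ∧ q.2 % p = q'.2 % p := by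
      intro p hp
      have := congrFun (congrFun he p) hp
      simpa using this
    have key : ∀ x y : ℕ, x < n → y < n → (∀ p ∈ n.primeFactors, x % p = y % p) → x = y := by
      intro x y hx hy h
      refine Nat.ModEq.eq_of_lt_of_lt (m := n) ?_ hx hy
      rw [Nat.modEq_iff_dvd, ← Nat.prod_primeFactors_of_squarefree hn, Nat.cast_prod]
      refine Finset.prod_dvd_of_coprime ?_ fun p hp => Nat.modEq_iff_dvd.mp (h p hp)
      intro p hp p' hp' hne
      exact Nat.isCoprime_iff_coprime.mpr ((Nat.coprime_primes (Nat.prime_of_mem_primeFactors hp)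
        (Nat.prime_of_mem_primeFactors hp')).mpr hne)
    exact Prod.ext (key _ _ hq.1 hq'.1 fun p hp => (he' p hp).1)
      (key _ _ hq.2 hq'.2 fun p hp => (he' p hp).2)

open Classical in
/-- The pairs for which `n` passes the test. -/
noncomputable def passSet (B n : ℕ) : Finset (ℕ × ℕ) :=
  (range n ×ˢ range n).filter fun q => PassesQFT B n (q.1 : ℤ) (q.2 : ℤ)

theorem card_passSet (B n : ℕ) : (passSet B n).card = passCount B n := rfl

theorem passesQFT_of_mem {B n : ℕ} {q : ℕ × ℕ} (h : q ∈ passSet B n) :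
    PassesQFT B n (q.1 : ℤ) (q.2 : ℤ) := by
  classical
  exact (mem_filter.mp h).2

theorem qftPoly_mod (p b c : ℕ) :
    qftPoly p ((b % p : ℕ) : ℤ) ((c % p : ℕ) : ℤ) = qftPoly p b c := by
  simp only [qftPoly, Int.cast_natCast, ZMod.natCast_mod]

theorem LocalPass.mod {p n b c : ℕ} (h : LocalPass p n b c) :
    LocalPass p n ((b % p : ℕ) : ℤ) ((c % p : ℕ) : ℤ) := by
  refine ⟨?_, ?_, ?_, ?_⟩
  · simpa only [Int.cast_natCast, ZMod.natCast_mod] using h.const_ne_zero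
  · have := h.disc_ne_zero
    push_cast at this
    push_cast [ZMod.natCast_mod]
    exact this
  · simpa only [qftPoly_mod] using h.half_dvd
  · simpa only [qftPoly_mod, Int.cast_natCast, ZMod.natCast_mod] using h.full_dvd

/-- The counting engine: local degree bounds `d p` multiply, and each prime contributes a factor 2
because the coprime divisors of `g p` are quadratics. -/
theorem two_pow_mul_card_le {B n : ℕ} (hn : Squarefree n) {S : Finset (ℕ × ℕ)}
    (hS : S ⊆ passSet B n) (g : ∀ p : ℕ, (ZMod p)[X]) (d : ℕ → ℕ)
    (hg : ∀ p ∈ n.primeFactors, g p ≠ 0 ∧ (g p).natDegree ≤ d p)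
    (hdvd : ∀ q ∈ S, ∀ p ∈ n.primeFactors, qftPoly p q.1 q.2 ∣ g p) :
    2 ^ n.primeFactors.card * S.card ≤ ∏ p ∈ n.primeFactors, d p := by
  have hsub : S ⊆ range n ×ˢ range n := by
    classical
    exact hS.trans (filter_subset _ _)
  calc 2 ^ n.primeFactors.card * S.card
      ≤ 2 ^ n.primeFactors.card *
        ∏ p ∈ n.primeFactors, (S.image fun q => (q.1 % p, q.2 % p)).card :=
        Nat.mul_le_mul_left _ (card_le_prod_card_image hn hsub)
    _ = ∏ p ∈ n.primeFactors, 2 * (S.image fun q => (q.1 % p, q.2 % p)).card := by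
        rw [Finset.prod_mul_distrib, Finset.prod_const]
    _ ≤ ∏ p ∈ n.primeFactors, d p := by
        refine Finset.prod_le_prod' fun p hp => ?_
        have hpp := Nat.prime_of_mem_primeFactors hp
        have hpn := Nat.dvd_of_mem_primeFactors hp
        have : Fact p.Prime := ⟨hpp⟩
        refine (two_mul_card_le_natDegree (n := n) _ ?_ (hg p hp).1 ?_).trans (hg p hp).2
        · intro q hq
          obtain ⟨q, hq', rfl⟩ := mem_image.mp hq
          exact ⟨Nat.mod_lt _ hpp.pos, Nat.mod_lt _ hpp.pos,
            ((passesQFT_of_mem (hS hq')).localPass hpp hpn).mod⟩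
        · intro q hq
          obtain ⟨q, hq', rfl⟩ := mem_image.mp hq
          rw [qftPoly_mod]
          exact hdvd q hq' p hp

theorem X_pow_sub_one_bound {p m : ℕ} (hp : p.Prime) (hm : 0 < m) :
    (X ^ m - 1 : (ZMod p)[X]) ≠ 0 ∧ (X ^ m - 1 : (ZMod p)[X]).natDegree ≤ m := by
  have : Fact p.Prime := ⟨hp⟩
  rw [← C_1]
  exact ⟨X_pow_sub_C_ne_zero hm _, natDegree_X_pow_sub_C.le⟩

theorem X_pow_add_one_bound {p m : ℕ} (hp : p.Prime) (hm : 0 < m) :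
    (X ^ m + 1 : (ZMod p)[X]) ≠ 0 ∧ (X ^ m + 1 : (ZMod p)[X]).natDegree ≤ m := by
  have : Fact p.Prime := ⟨hp⟩
  rw [← C_1]
  exact ⟨X_pow_add_C_ne_zero hm _, natDegree_X_pow_add_C.le⟩

/-! ### Split primes -/

/-- The discriminant attached to `q` is a square modulo `p`. -/
def SplitAt (p : ℕ) (q : ℕ × ℕ) : Prop :=
  IsSquare ((((q.1 : ℤ) ^ 2 + 4 * (q.2 : ℤ) : ℤ)) : ZMod p)

theorem prime_ne_two_of_mem {n p : ℕ} (hodd : Odd n) (hp : p ∈ n.primeFactors) : p ≠ 2 := by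
  rintro rfl
  obtain ⟨k, rfl⟩ := Nat.dvd_of_mem_primeFactors hp
  exact (Nat.not_even_iff_odd.mpr hodd) (even_two_mul k)

open Classical in
-- Each prime of `W` has degree bound p instead of p², and the missing factor p exceeds B.
theorem card_split_le {B n : ℕ} (hn : Squarefree n) (hodd : Odd n)
    (hB : ∀ p ∈ n.primeFactors, B < p) {W : Finset ℕ} (hW : W ⊆ n.primeFactors) :
    2 ^ n.primeFactors.card * B ^ W.card *
      ((passSet B n).filter fun q => ∀ p ∈ W, SplitAt p q).card ≤ n ^ 2 := by
  have h1 := two_pow_mul_card_le hn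
    (S := (passSet B n).filter fun q => ∀ p ∈ W, SplitAt p q) (filter_subset _ _)
    (fun p => if p ∈ W then X ^ (p - 1) - 1 else X ^ (p ^ 2 - 1) - 1)
    (fun p => if p ∈ W then p else p ^ 2) ?_ ?_
  · calc _ = B ^ W.card * (2 ^ n.primeFactors.card *
          ((passSet B n).filter fun q => ∀ p ∈ W, SplitAt p q).card) := by ring
      _ ≤ (∏ p ∈ n.primeFactors, if p ∈ W then p else 1) *
          ∏ p ∈ n.primeFactors, if p ∈ W then p else p ^ 2 := by
          refine Nat.mul_le_mul ?_ h1
          rw [Finset.prod_ite_mem, Finset.inter_eq_right.mpr hW, ← Finset.prod_const]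
          exact Finset.prod_le_prod' fun p hp => (hB p (hW hp)).le
      _ = ∏ p ∈ n.primeFactors, p ^ 2 := by
          rw [← Finset.prod_mul_distrib]
          refine Finset.prod_congr rfl fun p _ => ?_
          split_ifs <;> ring
      _ = n ^ 2 := by rw [Finset.prod_pow, Nat.prod_primeFactors_of_squarefree hn]
  · intro p hp
    have hpp := Nat.prime_of_mem_primeFactors hp
    have h2 := hpp.two_le
    have h3 : 1 < p ^ 2 := Nat.one_lt_pow two_ne_zero hpp.one_lt
    split_ifs
    · have := X_pow_sub_one_bound (m := p - 1) hpp (by omega)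
      exact ⟨this.1, this.2.trans (by omega)⟩
    · have := X_pow_sub_one_bound (m := p ^ 2 - 1) hpp (by omega)
      exact ⟨this.1, this.2.trans (by omega)⟩
  · intro q hq p hp
    have hpp := Nat.prime_of_mem_primeFactors hp
    have hpn := Nat.dvd_of_mem_primeFactors hp
    have : Fact p.Prime := ⟨hpp⟩
    have hp2 := prime_ne_two_of_mem hodd hp
    rw [mem_filter] at hq
    have hl := (passesQFT_of_mem hq.1).localPass hpp hpn
    split_ifs with h
    · exact hl.dvd_of_isSquare_disc hp2 (hq.2 p h)
    · exact hl.dvd_X_pow_card_sub_one hp2 hodd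

open Classical in
theorem card_many_split_le {B n w : ℕ} (hn : Squarefree n) (hodd : Odd n)
    (hB : ∀ p ∈ n.primeFactors, B < p) :
    2 ^ n.primeFactors.card * B ^ w *
      ((passSet B n).filter fun q => w ≤ (n.primeFactors.filter fun p => SplitAt p q).card).card ≤
      n.primeFactors.card.choose w * n ^ 2 := by
  have hsub : ((passSet B n).filter fun q =>
      w ≤ (n.primeFactors.filter fun p => SplitAt p q).card) ⊆
      (powersetCard w n.primeFactors).biUnion fun W =>
        (passSet B n).filter fun q => ∀ p ∈ W, SplitAt p q := by
    intro q hq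
    rw [mem_filter] at hq
    obtain ⟨W, hW, hcard⟩ := Finset.exists_subset_card_eq hq.2
    rw [mem_biUnion]
    refine ⟨W, mem_powersetCard.mpr ⟨hW.trans (filter_subset _ _), hcard⟩, mem_filter.mpr
      ⟨hq.1, fun p hp => (mem_filter.mp (hW hp)).2⟩⟩
  calc _ ≤ 2 ^ n.primeFactors.card * B ^ w * ∑ W ∈ powersetCard w n.primeFactors,
        ((passSet B n).filter fun q => ∀ p ∈ W, SplitAt p q).card :=
        Nat.mul_le_mul_left _ ((Finset.card_le_card hsub).trans Finset.card_biUnion_le)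
    _ = ∑ W ∈ powersetCard w n.primeFactors, 2 ^ n.primeFactors.card * B ^ w *
        ((passSet B n).filter fun q => ∀ p ∈ W, SplitAt p q).card := Finset.mul_sum _ _ _
    _ ≤ ∑ W ∈ powersetCard w n.primeFactors, n ^ 2 := by
        refine Finset.sum_le_sum fun W hW => ?_
        rw [mem_powersetCard] at hW
        have := card_split_le hn hodd hB hW.1
        rwa [hW.2] at this
    _ = _ := by rw [Finset.sum_const, card_powersetCard, smul_eq_mul]

theorem jacobiSym_eq_prod_primeFactors {n : ℕ} (hn : Squarefree n) (a : ℤ) :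
    jacobiSym a n = ∏ p ∈ n.primeFactors, jacobiSym a p := by
  conv_lhs => rw [← Nat.prod_primeFactorsList hn.ne_zero]
  rw [jacobiSym.list_prod_right fun p hp => (Nat.prime_of_mem_primeFactorsList hp).ne_zero,
    Nat.primeFactors, List.prod_toFinset _ ((Nat.squarefree_iff_nodup_primeFactorsList
      hn.ne_zero).mp hn)]

open Classical in
-- The Jacobi symbol -1 is a product of local signs, with -1 exactly at the inert primes.
theorem odd_card_not_split {B n : ℕ} (hn : Squarefree n) {q : ℕ × ℕ} (hq : q ∈ passSet B n) :
    Odd (n.primeFactors.filter fun p => ¬ SplitAt p q).card := by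
  have hpass := passesQFT_of_mem hq
  have hj := hpass.2.2.1.1
  rw [jacobiSym_eq_prod_primeFactors hn] at hj
  have hterm : ∀ p ∈ n.primeFactors, jacobiSym ((q.1 : ℤ) ^ 2 + 4 * (q.2 : ℤ)) p =
      if ¬ SplitAt p q then -1 else 1 := by
    intro p hp
    have hpp := Nat.prime_of_mem_primeFactors hp
    have : Fact p.Prime := ⟨hpp⟩
    have hne := (hpass.localPass hpp (Nat.dvd_of_mem_primeFactors hp)).disc_ne_zero
    rw [← jacobiSym.legendreSym.to_jacobiSym]
    split_ifs with h
    · exact (legendreSym.eq_one_iff p hne).mpr h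
    · exact (legendreSym.eq_neg_one_iff p).mpr h
  rw [Finset.prod_congr rfl hterm, Finset.prod_ite, Finset.prod_const, Finset.prod_const_one,
    mul_one] at hj
  by_contra hev
  rw [Nat.not_odd_iff_even] at hev
  rw [hev.neg_one_pow] at hj
  norm_num at hj

open Classical in
/-- The passing pairs whose discriminant is a non-square modulo every prime factor of `n`. -/
noncomputable def inertSet (B n : ℕ) : Finset (ℕ × ℕ) :=
  (passSet B n).filter fun q => ∀ p ∈ n.primeFactors, ¬ SplitAt p q

open Classical in
theorem passSet_subset_of_even {B n : ℕ} (hn : Squarefree n) (hk : Even n.primeFactors.card) :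
    passSet B n ⊆
      (passSet B n).filter fun q => 1 ≤ (n.primeFactors.filter fun p => SplitAt p q).card := by
  intro q hq
  refine mem_filter.mpr ⟨hq, ?_⟩
  have h1 := odd_card_not_split hn hq
  have h2 := Finset.card_filter_add_card_filter_not (s := n.primeFactors) (fun p => SplitAt p q)
  by_contra! h
  rw [Nat.lt_one_iff.mp h, zero_add] at h2
  rw [h2] at h1
  exact Nat.not_odd_iff_even.mpr hk h1

open Classical in
theorem passSet_subset_of_odd {B n : ℕ} (hn : Squarefree n) (hk : Odd n.primeFactors.card) :
    passSet B n ⊆ ((passSet B n).filter fun q =>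
      2 ≤ (n.primeFactors.filter fun p => SplitAt p q).card) ∪ inertSet B n := by
  intro q hq
  have h1 := odd_card_not_split hn hq
  have h2 := Finset.card_filter_add_card_filter_not (s := n.primeFactors) (fun p => SplitAt p q)
  rw [mem_union, inertSet, mem_filter, mem_filter]
  by_cases h : 2 ≤ (n.primeFactors.filter fun p => SplitAt p q).card
  · exact Or.inl ⟨hq, h⟩
  · right
    refine ⟨hq, ?_⟩
    have h0 : (n.primeFactors.filter fun p => SplitAt p q).card = 0 := by
      rw [Nat.odd_iff] at h1 hk
      omega
    rw [Finset.card_eq_zero, Finset.filter_eq_empty_iff] at h0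
    exact fun p hp => h0 hp

/-! ### All primes inert: three prime factors -/

/-- G divides the difference of the two products. The degree-six terms cancel, leaving a quantity
that is positive because a ≠ b and at most (ab)² + (bc)² + (ac)². Each summand gains B² from the
omitted variable. -/
theorem mul_sq_le_of_dvd_cofactor_products {a b c B G : ℕ} (ha : B < a) (hb : B < b) (hc : B < c)
    (hB : 0 < B) (hab : a ≠ b)
    (h1 : G ∣ (a ^ 2 - 1) * (b ^ 2 - 1) * (c ^ 2 - 1))
    (h2 : G ∣ (b * c - 1) * (a * c - 1) * (a * b - 1)) :
    G * B ^ 2 ≤ 3 * (a * b * c) ^ 2 := by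
  have pos : ∀ x y : ℕ, B < x → B < y → 1 ≤ x * y := fun x y hx hy =>
    Nat.mul_pos (by omega) (by omega)
  have pa : 1 ≤ a ^ 2 := by rw [sq]; exact pos a a ha ha
  have pb : 1 ≤ b ^ 2 := by rw [sq]; exact pos b b hb hb
  have pc : 1 ≤ c ^ 2 := by rw [sq]; exact pos c c hc hc
  have d1 : (G : ℤ) ∣ ((a : ℤ) ^ 2 - 1) * ((b : ℤ) ^ 2 - 1) * ((c : ℤ) ^ 2 - 1) := by
    have := Int.natCast_dvd_natCast.mpr h1
    rw [Nat.cast_mul, Nat.cast_mul, Nat.cast_sub pa, Nat.cast_sub pb, Nat.cast_sub pc] at this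
    exact_mod_cast this
  have d2 : (G : ℤ) ∣ ((b : ℤ) * c - 1) * ((a : ℤ) * c - 1) * ((a : ℤ) * b - 1) := by
    have := Int.natCast_dvd_natCast.mpr h2
    rw [Nat.cast_mul, Nat.cast_mul, Nat.cast_sub (pos b c hb hc), Nat.cast_sub (pos a c ha hc),
      Nat.cast_sub (pos a b ha hb)] at this
    exact_mod_cast this
  zify at *
  generalize (a : ℤ) = a at *
  generalize (b : ℤ) = b at *
  generalize (c : ℤ) = c at *
  generalize (B : ℤ) = B at *
  generalize (G : ℤ) = G at *
  have hdiff : (b * c - 1) * (a * c - 1) * (a * b - 1) - (a ^ 2 - 1) * (b ^ 2 - 1) * (c ^ 2 - 1) =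
      (a * b * (a * b) - a * b * (b * c) + b * c * (b * c) - a * b * (a * c) + a * c * (a * c)
        - a * c * (b * c)) - (a ^ 2 + b ^ 2 + c ^ 2 - a * b - b * c - a * c) := by ring
  have hpos : 0 < (b * c - 1) * (a * c - 1) * (a * b - 1) -
      (a ^ 2 - 1) * (b ^ 2 - 1) * (c ^ 2 - 1) := by
    have e : 2 * ((b * c - 1) * (a * c - 1) * (a * b - 1) -
      (a ^ 2 - 1) * (b ^ 2 - 1) * (c ^ 2 - 1)) =
      (a - c) ^ 2 * (b ^ 2 - 1) + (b - a) ^ 2 * (c ^ 2 - 1) + (b - c) ^ 2 * (a ^ 2 - 1) := by ring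
    have t1 : 0 ≤ (a - c) ^ 2 * (b ^ 2 - 1) := mul_nonneg (sq_nonneg _) (by linarith)
    have t2 : 0 < (b - a) ^ 2 * (c ^ 2 - 1) :=
      mul_pos (sq_pos_iff.mpr (sub_ne_zero.mpr (Ne.symm hab))) (by nlinarith)
    have t3 : 0 ≤ (b - c) ^ 2 * (a ^ 2 - 1) := mul_nonneg (sq_nonneg _) (by linarith)
    linarith
  have hle := Int.le_of_dvd hpos (dvd_sub d2 d1)
  have hsmall : (b * c - 1) * (a * c - 1) * (a * b - 1) -
      (a ^ 2 - 1) * (b ^ 2 - 1) * (c ^ 2 - 1) ≤ (a * b) ^ 2 + (b * c) ^ 2 + (a * c) ^ 2 := by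
    rw [hdiff]
    have a0 : 0 ≤ a := by linarith
    have b0 : 0 ≤ b := by linarith
    have c0 : 0 ≤ c := by linarith
    have p1 : 0 ≤ a * b * (b * c) := by positivity
    have p2 : 0 ≤ a * b * (a * c) := by positivity
    have p3 : 0 ≤ a * c * (b * c) := by positivity
    nlinarith [sq_nonneg (a - b), sq_nonneg (b - c), sq_nonneg (a - c)]
  have sqle : ∀ x y z : ℤ, 0 ≤ x → 0 ≤ y → B < z → (x * y) ^ 2 * B ^ 2 ≤ (x * y * z) ^ 2 := by
    intro x y z hx hy hz
    rw [← mul_pow]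
    exact pow_le_pow_left₀ (by positivity) (mul_le_mul_of_nonneg_left hz.le (by positivity)) 2
  have s1 := sqle a b c (by linarith) (by linarith) hc
  have s2 := sqle b c a (by linarith) (by linarith) ha
  have s3 := sqle a c b (by linarith) (by linarith) hb
  calc G * B ^ 2 ≤ ((a * b) ^ 2 + (b * c) ^ 2 + (a * c) ^ 2) * B ^ 2 :=
        mul_le_mul_of_nonneg_right (hle.trans hsmall) (by positivity)
    _ ≤ (a * b * c) ^ 2 + (b * c * a) ^ 2 + (a * c * b) ^ 2 := by linarith
    _ = 3 * (a * b * c) ^ 2 := by ring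

theorem inertSet_subset (B n : ℕ) : inertSet B n ⊆ passSet B n := by
  classical
  exact filter_subset _ _

theorem not_splitAt_of_mem {B n p : ℕ} {q : ℕ × ℕ} (hq : q ∈ inertSet B n)
    (hp : p ∈ n.primeFactors) : ¬ SplitAt p q := by
  classical
  exact (mem_filter.mp hq).2 p hp

theorem card_inertSet_le_of_three {B n : ℕ} (hn : Squarefree n) (hodd : Odd n) (hB0 : 0 < B)
    (hB : ∀ p ∈ n.primeFactors, B < p) (hk : n.primeFactors.card = 3) :
    8 * B ^ 2 * (inertSet B n).card ≤ 3 * n ^ 2 := by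
  have h1 := two_pow_mul_card_le hn (inertSet_subset B n)
    (fun p => X ^ Nat.gcd (p ^ 2 - 1) (n / p - 1) - 1) (fun p => Nat.gcd (p ^ 2 - 1) (n / p - 1))
    ?_ ?_
  · rw [hk] at h1
    obtain ⟨a, b, c, hab, hac, hbc, habc⟩ := Finset.card_eq_three.mp hk
    have hprod := Nat.prod_primeFactors_of_squarefree hn
    rw [habc] at hprod h1 hB
    have e3 : ∀ f : ℕ → ℕ, ∏ p ∈ ({a, b, c} : Finset ℕ), f p = f a * f b * f c := by
      intro f
      rw [Finset.prod_insert (by simp [hab, hac]), Finset.prod_insert (by simp [hbc]),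
        Finset.prod_singleton, mul_assoc]
    rw [e3] at h1 hprod
    have ha := hB a (by simp)
    have hb := hB b (by simp)
    have hc := hB c (by simp)
    have na : n / a = b * c := by
      rw [← hprod, mul_assoc, Nat.mul_div_cancel_left _ (by omega)]
    have nb : n / b = a * c := by
      rw [← hprod, mul_comm a b, mul_assoc, Nat.mul_div_cancel_left _ (by omega)]
    have nc : n / c = a * b := by
      rw [← hprod, Nat.mul_div_cancel _ (by omega)]
    rw [na, nb, nc] at h1
    have := mul_sq_le_of_dvd_cofactor_products ha hb hc hB0 hab
      (mul_dvd_mul (mul_dvd_mul (Nat.gcd_dvd_left (a ^ 2 - 1) (b * c - 1))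
        (Nat.gcd_dvd_left (b ^ 2 - 1) (a * c - 1))) (Nat.gcd_dvd_left (c ^ 2 - 1) (a * b - 1)))
      (mul_dvd_mul (mul_dvd_mul (Nat.gcd_dvd_right _ _) (Nat.gcd_dvd_right _ _))
        (Nat.gcd_dvd_right _ _))
    rw [hprod] at this
    calc 8 * B ^ 2 * (inertSet B n).card = 2 ^ 3 * (inertSet B n).card * B ^ 2 := by ring
      _ ≤ _ := (Nat.mul_le_mul_right _ h1).trans this
  · intro p hp
    have hpp := Nat.prime_of_mem_primeFactors hp
    have h3 : 1 < p ^ 2 := Nat.one_lt_pow two_ne_zero hpp.one_lt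
    exact X_pow_sub_one_bound hpp (Nat.gcd_pos_of_pos_left _ (by omega))
  · intro q hq p hp
    have hpp := Nat.prime_of_mem_primeFactors hp
    have hpn := Nat.dvd_of_mem_primeFactors hp
    have : Fact p.Prime := ⟨hpp⟩
    exact ((passesQFT_of_mem (inertSet_subset B n hq)).localPass hpp hpn).dvd_X_pow_gcd_sub_one
      (prime_ne_two_of_mem hodd hp) (Nat.div_pos (Nat.le_of_dvd hn.ne_zero.bot_lt hpn) hpp.pos)
      hodd (Nat.mul_div_cancel' hpn).symm (not_splitAt_of_mem hq hp)

/-! ### All primes inert: synchronised 2-parts -/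

/-- The exponent of `2` in `(p ^ 2 - 1) / 2`. -/
def halfExp (p : ℕ) : ℕ := ((p ^ 2 - 1) / 2).factorization 2

/-- The odd part of `(p ^ 2 - 1) / 2`. -/
def halfOdd (p : ℕ) : ℕ := (p ^ 2 - 1) / 2 / 2 ^ halfExp p

theorem two_pow_halfExp_mul_halfOdd (p : ℕ) :
    (p ^ 2 - 1) / 2 = 2 ^ halfExp p * halfOdd p :=
  (Nat.ordProj_mul_ordCompl_eq_self _ 2).symm

theorem four_dvd_half {p : ℕ} (hp : Odd p) : 4 ∣ (p ^ 2 - 1) / 2 := by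
  have h := Nat.eight_dvd_sq_sub_one_of_odd hp
  omega

theorem half_ne_zero {p : ℕ} (hp : 1 < p) : (p ^ 2 - 1) / 2 ≠ 0 := by
  have : 2 ^ 2 ≤ p ^ 2 := Nat.pow_le_pow_left hp 2
  omega

theorem odd_halfOdd {p : ℕ} (hp : 1 < p) : Odd (halfOdd p) := by
  rw [← Nat.not_even_iff_odd, even_iff_two_dvd]
  exact Nat.not_dvd_ordCompl Nat.prime_two (half_ne_zero hp)

theorem two_le_halfExp {p : ℕ} (hp : Odd p) (hp1 : 1 < p) : 2 ≤ halfExp p :=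
  (Nat.prime_two.pow_dvd_iff_le_factorization (half_ne_zero hp1)).mp (four_dvd_half hp)

theorem geom_bound {x V : ℕ} (hx : 2 ≤ x) (hV : 2 ≤ V) :
    x ^ 2 * (1 + ∑ j ∈ range V, x ^ j) ≤ x ^ V * (x + 2) := by
  induction V, hV using Nat.le_induction with
  | base => simp [Finset.sum_range_succ]; nlinarith
  | succ V _ ih =>
    rw [Finset.sum_range_succ]
    have h1 : x ^ V * (x + 2) ≤ x ^ V * (2 * x) := Nat.mul_le_mul_left _ (by omega)
    calc x ^ 2 * (1 + (∑ j ∈ range V, x ^ j + x ^ V))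
        = x ^ 2 * (1 + ∑ j ∈ range V, x ^ j) + x ^ V * x ^ 2 := by ring
      _ ≤ x ^ V * (2 * x) + x ^ V * x ^ 2 := Nat.add_le_add_right (ih.trans h1) _
      _ = x ^ (V + 1) * (x + 2) := by ring

open Classical in
-- Step 5 yields one j valid at all primes at once, and j is below the least exponent V of 2 in (p²
-- - 1)/2. With T the product of the odd parts, each j allows at most (2^k)^j·T/2^k pairs, and x^s =
-- 1 allows T/2^k. Summing the geometric series against (2^k)^(V+1)·T ≤ n² gives the bound. V ≥ 2
-- since 8 ∣ p² - 1.
theorem card_inertSet_le {B n : ℕ} (hn : Squarefree n) (hn1 : 1 < n) (hodd : Odd n) :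
    16 ^ n.primeFactors.card * (inertSet B n).card ≤ (2 ^ n.primeFactors.card + 2) * n ^ 2 := by
  set P := n.primeFactors with hP
  set k := P.card with hk
  obtain ⟨p₀, hp₀, hmin⟩ := Finset.exists_min_image P halfExp
    (Nat.nonempty_primeFactors.mpr hn1)
  set V := halfExp p₀ with hV
  have hpodd : ∀ p ∈ P, Odd p := fun p hp =>
    (Nat.prime_of_mem_primeFactors hp).odd_of_ne_two (prime_ne_two_of_mem hodd hp)
  have hp1 : ∀ p ∈ P, 1 < p := fun p hp => (Nat.prime_of_mem_primeFactors hp).one_lt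
  set N₀ := (inertSet B n).filter fun q => ∀ p ∈ P, qftPoly p q.1 q.2 ∣ X ^ halfOdd p - 1 with hN₀
  set N : ℕ → Finset (ℕ × ℕ) := fun j => (inertSet B n).filter fun q =>
    ∀ p ∈ P, qftPoly p q.1 q.2 ∣ X ^ (2 ^ j * halfOdd p) + 1 with hN
  have hcover : inertSet B n ⊆ N₀ ∪ (range V).biUnion N := by
    intro q hq
    have hpass := passesQFT_of_mem (inertSet_subset B n hq)
    have hs := sPart_odd hpass.1
    have hloc : ∀ p ∈ P, LocalPass p n q.1 q.2 := fun p hp =>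
      hpass.localPass (Nat.prime_of_mem_primeFactors hp) (Nat.dvd_of_mem_primeFactors hp)
    rw [mem_union]
    rcases hpass.2.2.2.2.2.2.2.dvd with h | ⟨j, -, h⟩
    · left
      rw [hN₀, mem_filter]
      refine ⟨hq, fun p hp => ?_⟩
      have : Fact p.Prime := ⟨Nat.prime_of_mem_primeFactors hp⟩
      have hmap := Polynomial.map_dvd (ZMod.castHom (Nat.dvd_of_mem_primeFactors hp) (ZMod p)) h
      rw [qftPoly_map, Polynomial.map_sub, Polynomial.map_pow, map_X, Polynomial.map_one] at hmap
      exact (hloc p hp).dvd_of_odd_order (prime_ne_two_of_mem hodd hp) hodd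
        (not_splitAt_of_mem hq hp) hs (two_pow_halfExp_mul_halfOdd p) hmap
    · right
      have key : ∀ p ∈ P, j < halfExp p ∧ qftPoly p q.1 q.2 ∣ X ^ (2 ^ j * halfOdd p) + 1 := by
        intro p hp
        have : Fact p.Prime := ⟨Nat.prime_of_mem_primeFactors hp⟩
        have hmap := Polynomial.map_dvd (ZMod.castHom (Nat.dvd_of_mem_primeFactors hp) (ZMod p)) h
        rw [qftPoly_map, Polynomial.map_add, Polynomial.map_pow, map_X, Polynomial.map_one] at hmap
        exact (hloc p hp).dvd_of_even_order (prime_ne_two_of_mem hodd hp) hodd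
          (not_splitAt_of_mem hq hp) hs (odd_halfOdd (hp1 p hp)) (two_pow_halfExp_mul_halfOdd p)
          hmap
      rw [mem_biUnion]
      exact ⟨j, mem_range.mpr (key p₀ hp₀).1, mem_filter.mpr ⟨hq, fun p hp => (key p hp).2⟩⟩
  set T := ∏ p ∈ P, halfOdd p with hT
  have hN₀card : 2 ^ k * N₀.card ≤ T := by
    refine two_pow_mul_card_le hn ((filter_subset _ _).trans (inertSet_subset B n))
      (fun p => X ^ halfOdd p - 1) halfOdd ?_ fun q hq => (mem_filter.mp hq).2
    exact fun p hp => X_pow_sub_one_bound (Nat.prime_of_mem_primeFactors hp)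
      (odd_halfOdd (hp1 p hp)).pos
  have hNcard : ∀ j, 2 ^ k * (N j).card ≤ (2 ^ k) ^ j * T := by
    intro j
    have := two_pow_mul_card_le hn (S := N j) ((filter_subset _ _).trans (inertSet_subset B n))
      (fun p => X ^ (2 ^ j * halfOdd p) + 1) (fun p => 2 ^ j * halfOdd p) ?_
      fun q hq => (mem_filter.mp hq).2
    · rwa [Finset.prod_mul_distrib, Finset.prod_const, ← pow_mul, mul_comm j, pow_mul] at this
    · exact fun p hp => X_pow_add_one_bound (Nat.prime_of_mem_primeFactors hp)
        (Nat.mul_pos (by positivity) (odd_halfOdd (hp1 p hp)).pos)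
  have hsum : 2 ^ k * (inertSet B n).card ≤ T * (1 + ∑ j ∈ range V, (2 ^ k) ^ j) := by
    calc 2 ^ k * (inertSet B n).card ≤ 2 ^ k * (N₀.card + ∑ j ∈ range V, (N j).card) :=
          Nat.mul_le_mul_left _ ((Finset.card_le_card hcover).trans ((card_union_le _ _).trans
            (Nat.add_le_add_left Finset.card_biUnion_le _)))
      _ = 2 ^ k * N₀.card + ∑ j ∈ range V, 2 ^ k * (N j).card := by rw [mul_add, Finset.mul_sum]
      _ ≤ T + ∑ j ∈ range V, (2 ^ k) ^ j * T :=
          Nat.add_le_add hN₀card (Finset.sum_le_sum fun j _ => hNcard j)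
      _ = _ := by rw [← Finset.sum_mul]; ring
  have hTn : (2 ^ k) ^ (V + 1) * T ≤ n ^ 2 := by
    rw [← pow_mul, mul_comm k, pow_mul, hk, ← Finset.prod_const, hT, ← Finset.prod_mul_distrib]
    conv_rhs => rw [← Nat.prod_primeFactors_of_squarefree hn, ← Finset.prod_pow]
    refine Finset.prod_le_prod' fun p hp => ?_
    have h1 := two_pow_halfExp_mul_halfOdd p
    have h2 : 2 ^ V * halfOdd p ≤ (p ^ 2 - 1) / 2 := by
      rw [h1]
      exact Nat.mul_le_mul_right _ (Nat.pow_le_pow_right two_pos (hmin p hp))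
    rw [pow_succ, mul_right_comm]
    omega
  have hx : 2 ≤ 2 ^ k := by
    have : k ≠ 0 := Finset.card_ne_zero_of_mem hp₀
    exact Nat.le_self_pow this 2
  have hgeom := geom_bound hx (two_le_halfExp (hpodd p₀ hp₀) (hp1 p₀ hp₀))
  calc 16 ^ k * (inertSet B n).card
      = (2 ^ k) ^ 3 * (2 ^ k * (inertSet B n).card) := by
        rw [show 16 = 2 ^ 4 by norm_num, ← pow_mul, mul_comm 4 k, pow_mul]; ring
    _ ≤ (2 ^ k) ^ 3 * (T * (1 + ∑ j ∈ range V, (2 ^ k) ^ j)) := Nat.mul_le_mul_left _ hsum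
    _ = 2 ^ k * T * ((2 ^ k) ^ 2 * (1 + ∑ j ∈ range V, (2 ^ k) ^ j)) := by ring
    _ ≤ 2 ^ k * T * ((2 ^ k) ^ V * (2 ^ k + 2)) := Nat.mul_le_mul_left _ hgeom
    _ = (2 ^ k + 2) * ((2 ^ k) ^ (V + 1) * T) := by ring
    _ ≤ (2 ^ k + 2) * n ^ 2 := Nat.mul_le_mul_left _ hTn

/-! ### Numerical estimates and conclusion -/

theorem choose_two_mul_le {k : ℕ} (hk : 5 ≤ k) : 32 * k.choose 2 ≤ 10 * 2 ^ k := by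
  suffices 32 * k.choose 2 ≤ 10 * 2 ^ k ∧ 32 * k ≤ 10 * 2 ^ k from this.1
  induction k, hk using Nat.le_induction with
  | base => decide
  | succ k _ ih =>
    have : (k + 1).choose 2 = k + k.choose 2 := by
      rw [Nat.choose_succ_succ' k 1, Nat.choose_one_right]
    rw [this, pow_succ]
    omega

theorem two_pow_add_two_mul_le {k : ℕ} (hk : 5 ≤ k) :
    2 ^ 20 * (2 ^ k + 2) ≤ 34 * 16 ^ k := by
  have h : 2 ^ 5 ≤ 2 ^ k := Nat.pow_le_pow_right two_pos hk
  rw [show 16 = 2 ^ 4 by norm_num, ← pow_mul, mul_comm 4 k, pow_mul]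
  generalize 2 ^ k = x at *
  have h3 : (2 ^ 5) ^ 3 ≤ x ^ 3 := Nat.pow_le_pow_left h 3
  have h4 : (2 ^ 5) ^ 3 * x ≤ x ^ 3 * x := Nat.mul_le_mul_right _ h3
  rw [← pow_succ] at h4
  norm_num at *
  omega

theorem le_two_pow_pred {k : ℕ} : 2 * k ≤ 2 ^ k := by
  cases k with
  | zero => simp
  | succ k =>
    have : k < 2 ^ k := Nat.lt_two_pow_self
    rw [pow_succ]
    omega

theorem passCount_bound_of_squarefree {n : ℕ} (hn : Squarefree n) (hn1 : 1 < n)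
    (hodd : Odd n) (hcomp : ¬ n.Prime) (hB : ∀ p ∈ n.primeFactors, 50000 < p) :
    30840 * passCount 50000 n < n ^ 2 := by
  classical
  rw [← card_passSet]
  set k := n.primeFactors.card with hk
  have hn0 : 0 < n ^ 2 := by positivity
  rcases Nat.even_or_odd k with hev | hod
  · have h1 := card_many_split_le (w := 1) hn hodd hB
    have h2 := Finset.card_le_card (passSet_subset_of_even (B := 50000) hn hev)
    rw [← hk, Nat.choose_one_right, pow_one] at h1
    have h3 : 2 ^ k * (100000 * (passSet 50000 n).card) ≤ 2 ^ k * n ^ 2 := by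
      calc _ = 2 * (2 ^ k * 50000 * (passSet 50000 n).card) := by ring
        _ ≤ 2 * (k * n ^ 2) := Nat.mul_le_mul_left _ ((Nat.mul_le_mul_left _ h2).trans h1)
        _ = 2 * k * n ^ 2 := by ring
        _ ≤ _ := Nat.mul_le_mul_right _ le_two_pow_pred
    have := Nat.le_of_mul_le_mul_left h3 (by positivity)
    omega
  · have hk1 : k ≠ 1 := by
      intro h1
      obtain ⟨p, hp⟩ := Finset.card_eq_one.mp h1
      have hprod := Nat.prod_primeFactors_of_squarefree hn
      rw [hp, Finset.prod_singleton] at hprod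
      exact hcomp (hprod ▸ Nat.prime_of_mem_primeFactors (n := n) (hp ▸ mem_singleton_self p))
    have h1 := card_many_split_le (w := 2) hn hodd hB
    have h2 := (Finset.card_le_card (passSet_subset_of_odd (B := 50000) hn hod)).trans
      (card_union_le _ _)
    rw [← hk] at h1
    set S := ((passSet 50000 n).filter fun q =>
      2 ≤ (n.primeFactors.filter fun p => SplitAt p q).card).card with hS
    rcases eq_or_ne k 3 with h3 | h3
    · have h4 := card_inertSet_le_of_three hn hodd (by norm_num) hB h3
      rw [h3, show Nat.choose 3 2 = 3 from rfl] at h1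
      omega
    · have hk5 : 5 ≤ k := by
        rw [Nat.odd_iff] at hod
        omega
      have h4 := card_inertSet_le (B := 50000) hn hn1 hodd
      rw [← hk] at h4
      have c1 := choose_two_mul_le hk5
      have c2 := two_pow_add_two_mul_le hk5
      have b1 : 2 ^ k * (32 * 50000 ^ 2 * S) ≤ 2 ^ k * (10 * n ^ 2) := by
        calc _ = 32 * (2 ^ k * 50000 ^ 2 * S) := by ring
          _ ≤ 32 * (k.choose 2 * n ^ 2) := Nat.mul_le_mul_left _ h1
          _ = 32 * k.choose 2 * n ^ 2 := by ring
          _ ≤ 10 * 2 ^ k * n ^ 2 := Nat.mul_le_mul_right _ c1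
          _ = _ := by ring
      have b2 : 16 ^ k * (2 ^ 20 * (inertSet 50000 n).card) ≤ 16 ^ k * (34 * n ^ 2) := by
        calc _ = 2 ^ 20 * (16 ^ k * (inertSet 50000 n).card) := by ring
          _ ≤ 2 ^ 20 * ((2 ^ k + 2) * n ^ 2) := Nat.mul_le_mul_left _ h4
          _ = 2 ^ 20 * (2 ^ k + 2) * n ^ 2 := by ring
          _ ≤ 34 * 16 ^ k * n ^ 2 := Nat.mul_le_mul_right _ c2
          _ = _ := by ring
      have b1' := Nat.le_of_mul_le_mul_left b1 (by positivity)
      have b2' := Nat.le_of_mul_le_mul_left b2 (by positivity)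
      -- The margin is thin: 30840·34/2^20 is about 1.5·10⁻⁵ below 1, and the split pairs use only
      -- 30840·10/(32·50000²), about 4·10⁻⁶.
      norm_num at b1' b2'
      omega

theorem passCount_bound {n : ℕ} (hn1 : 1 < n) (hodd : Odd n) (hcomp : ¬ n.Prime)
    (hB : ∀ p : ℕ, p.Prime → p ∣ n → 50000 < p) :
    30840 * passCount 50000 n < n ^ 2 := by
  by_cases hn : Squarefree n
  · exact passCount_bound_of_squarefree hn hn1 hodd hcomp fun p hp =>
      hB p (Nat.prime_of_mem_primeFactors hp) (Nat.dvd_of_mem_primeFactors hp)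
  · rw [Nat.squarefree_iff_prime_squarefree] at hn
    push Not at hn
    obtain ⟨p, hp, k, rfl⟩ := hn
    have hbp := hB p hp ⟨p * k, by ring⟩
    have hk : 0 < k := Nat.pos_of_ne_zero (by rintro rfl; simp at hn1)
    have h := passCount_le_sq (B := 50000) (n := p * p * k) (m := p * k) ⟨k, by ring⟩
      (Nat.mul_pos hp.pos hk)
    have h2 : 50000 ^ 2 ≤ p ^ 2 := Nat.pow_le_pow_left hbp.le 2
    have h3 : 0 < (p * k) ^ 2 := pow_pos (Nat.mul_pos hp.pos hk) 2
    calc 30840 * passCount 50000 (p * p * k) ≤ 30840 * (p * k) ^ 2 := Nat.mul_le_mul_left _ h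
      _ < 50000 ^ 2 * (p * k) ^ 2 := by omega
      _ ≤ p ^ 2 * (p * k) ^ 2 := Nat.mul_le_mul_right _ h2
      _ = (p * p * k) ^ 2 := by ring

end Grantham

theorem theorem2p6 (n : ℕ) (hn : 1 < n) (hodd : Odd n) (hcomp : ¬ n.Prime) :
    0 < Grantham.pairCount n ∧ Grantham.rqftProbability 50000 n < 1 / 7710 := by
  have hM := Grantham.pairCount_pos hn hcomp
  refine ⟨hM, ?_⟩
  have hM' : (0 : ℝ) < Grantham.pairCount n := by exact_mod_cast hM
  rw [Grantham.rqftProbability, div_lt_div_iff₀ hM' (by norm_num), one_mul]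
  suffices Grantham.passCount 50000 n * 7710 < Grantham.pairCount n by exact_mod_cast this
  -- With no passing pair M > 0 is enough. A single passing pair already shows that n is a
  -- non-square with large prime factors.
  rcases Finset.eq_empty_or_nonempty (Grantham.passSet 50000 n) with h | ⟨q, hq⟩
  · rw [← Grantham.card_passSet, h, Finset.card_empty, zero_mul]
    exact hM
  · have hpass := Grantham.passesQFT_of_mem hq
    have hB : ∀ p : ℕ, p.Prime → p ∣ n → 50000 < p := fun p hp hpn =>
      hpass.lt_prime hcomp hp hpn
    have hmin := Nat.minFac_prime (n := n) (by omega)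
    have hminB := hB _ hmin (Nat.minFac_dvd n)
    have h3 : 3 * n.minFac ≤ n := by
      have := Nat.minFac_sq_le_self (by omega) hcomp
      nlinarith
    have h1 := Grantham.sq_le_four_mul_pairCount hn hodd hpass.2.2.2.2.1 hmin.one_lt
      (Nat.minFac_dvd n) h3
    have h2 := Grantham.passCount_bound hn hodd hcomp hB
    omega
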